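/- Theorem 2. Let $X_1,X_2,\dots$ be real random variables on a probability space $(\Omega,\mathcal F,\mathbf P)$, identically distributed (not necessarily stationary) with common distribution function $F$. Put $$\varphi(n)=\sup_{k\ge1}\sup\{|\mathbf P(B\mid A)-\mathbf P(B)|:\ A\in\mathcal F_1^k,\ B\in\mathcal F_{k+n}^\infty,\ \mathbf P(A)>0\},$$ where $\mathcal F_1^k=\sigma(X_i,\,1\le i\le k)$ and $\mathcal F_{k+n}^\infty=\sigma(X_i,\,i\ge k+n)$. Assume that $\{X_n\}$ is $\varphi$-mixing, i.e. $\varphi(n)\to0$ as $n\to\infty$, and that $\sum_{n\ge1}\varphi^{1/2}(2^n)<\infty$. Let $h:\mathbb R\to\mathbb R$ be a Borel measurable function and let $c_{ni}$ ($n\ge1$, $1\le i\le n$) be real constants. Let $X_{n:1}\le\dots\le X_{n:n}$ be the order statistics of $X_1,\dots,X_n$ and $$L_n=\frac1n\sum_{i=1}^n c_{ni}\,h(X_{n:i}).$$ Let $F^{-1}(t)=\inf\{x:F(x)\ge t\}$ and $H(t)=h(F^{-1}(t))$ for $0<t<1$, let $c_n(t)=c_{ni}$ for $t\in((i-1)/n,i/n]$,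 $i=1,\dots,n$, $c_n(0)=c_{n1}$, and $$\mu_n=\int_0^1c_n(t)H(t)\,dt .$$ Let $C_n(q)=n^{-1}\sum_{i=1}^n|c_{ni}|^q$ for $1\le q<\infty$ and $C_n(\infty)=\max_{i\le n}|c_{ni}|$. Suppose that at least one of the following conditions holds: (i) $H$ is continuous on $[0,1]$, in the sense that $H$ on $(0,1)$ extends to a continuous real function on $[0,1]$, and $\sup_{n\ge1}C_n(1)<\infty$; (ii) $\mathbf E|h(X_1)|^p<\infty$ and $\sup_{n\ge1}C_n(q)<\infty$ for some $1\le p<\infty$ and $1<q\le\infty$ with $1/p+1/q=1$. Then $c_nH$ is integrable on $[0,1]$ for every $n\ge1$ (so that $\mu_n$ exists), and $$L_n-\mu_n\to0\quad\text{almost surely as } n\to\infty .$$ -/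

import Mathlib

open MeasureTheory ProbabilityTheory Filter Topology
open scoped ENNReal

noncomputable section

namespace LStat

/-! Sequences and weights are indexed as in `X₁, X₂, …` and `c_{n1}, …, c_{nn}`: only the values
`X i` with `1 ≤ i` and `c n i` with `1 ≤ i ≤ n` are ever used. -/

/-- The `σ`-field generated by `X_i`, `i ∈ I`. -/
abbrev sigmaField {Ω : Type*} (X : ℕ → Ω → ℝ) (I : Set ℕ) : MeasurableSpace Ω :=
  ⨆ i ∈ I, MeasurableSpace.comap (X i) inferInstance

/-- The uniform mixing coefficient `φ(n)`: the supremum over `k ≥ 1` and over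
`A ∈ σ(X_1, …, X_k)` with `P(A) > 0`, `B ∈ σ(X_{k+n}, X_{k+n+1}, …)` of `|P(B|A) - P(B)|`. -/
def phiCoeff {Ω : Type*} [MeasurableSpace Ω] (P : Measure Ω) (X : ℕ → Ω → ℝ) (n : ℕ) : ℝ :=
  sSup {r : ℝ | ∃ k : ℕ, 1 ≤ k ∧ ∃ A B : Set Ω,
    MeasurableSet[sigmaField X (Set.Icc 1 k)] A ∧
    MeasurableSet[sigmaField X (Set.Ici (k + n))] B ∧
    0 < P A ∧ r = |(ProbabilityTheory.cond P A).real B - P.real B|}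

/-- The sequence `X_1, X_2, …` is `φ`-mixing. -/
def IsPhiMixing {Ω : Type*} [MeasurableSpace Ω] (P : Measure Ω) (X : ℕ → Ω → ℝ) : Prop :=
  Tendsto (phiCoeff P X) atTop (𝓝 0)

/-- The order statistics of the sample `X_1, …, X_n` in nondecreasing order;
`orderStat X n i ω` with `i : Fin n` is `X_{n:i+1}(ω)`. -/
def orderStat {Ω : Type*} (X : ℕ → Ω → ℝ) (n : ℕ) (i : Fin n) (ω : Ω) : ℝ :=
  (fun j : Fin n => X (j + 1) ω) (Tuple.sort (fun j : Fin n => X (j + 1) ω) i)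

/-- The `L`-statistic `L_n = n⁻¹ ∑_{i=1}^n c_{ni} h(X_{n:i})`. -/
def lStatistic {Ω : Type*} (c : ℕ → ℕ → ℝ) (h : ℝ → ℝ) (X : ℕ → Ω → ℝ) (n : ℕ) (ω : Ω) : ℝ :=
  (n : ℝ)⁻¹ * ∑ i : Fin n, c n (i + 1) * h (orderStat X n i ω)

/-- The quantile function `F⁻¹(t) = inf {x : F(x) ≥ t}` of a law `ν`, `F` its distribution
function. The set is nonempty and bounded below for `0 < t < 1`; nothing below depends on the values at
other `t`, where the infimum may be infinite. -/
def quantile (ν : Measure ℝ) (t : ℝ) : ℝ :=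
  sInf {x : ℝ | t ≤ cdf ν x}

/-- `H(t) = h(F⁻¹(t))`. -/
def kernelQuantile (h : ℝ → ℝ) (ν : Measure ℝ) (t : ℝ) : ℝ :=
  h (quantile ν t)

/-- The step function `c_n(t) = c_{ni}` for `t ∈ ((i-1)/n, i/n]`, `c_n(0) = c_{n1}`. -/
def stepWeight (c : ℕ → ℕ → ℝ) (n : ℕ) (t : ℝ) : ℝ :=
  c n (max 1 ⌈(n : ℝ) * t⌉₊)

/-- The centering constants `μ_n = ∫₀¹ c_n(t) H(t) dt`. -/
def centering (c : ℕ → ℕ → ℝ) (h : ℝ → ℝ) (ν : Measure ℝ) (n : ℕ) : ℝ :=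
  ∫ t in (0 : ℝ)..1, stepWeight c n t * kernelQuantile h ν t

open Classical in
/-- `C_n(q) = n⁻¹ ∑_{i ≤ n} |c_{ni}|^q` for `q < ∞` and `C_n(∞) = max_{i ≤ n} |c_{ni}|`. -/
def weightSize (c : ℕ → ℕ → ℝ) (q : ℝ≥0∞) (n : ℕ) : ℝ :=
  if q = ∞ then ⨆ i : Fin n, |c n (i + 1)|
  else (n : ℝ)⁻¹ * ∑ i : Fin n, |c n (i + 1)| ^ q.toReal

/-- `sup_{n ≥ 1} C_n(q) < ∞`. -/
def WeightsBounded (c : ℕ → ℕ → ℝ) (q : ℝ≥0∞) : Prop :=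
  BddAbove (weightSize c q '' Set.Ici 1)

/-- Condition (i): `H` is continuous on `[0,1]` and `sup_n C_n(1) < ∞`. As `F⁻¹(0)`, and possibly
`F⁻¹(1)`, is infinite, `H` at the endpoints stands for its limits there: `H` on `(0,1)` extends
to a continuous function on `[0,1]`. -/
def ConditionI (c : ℕ → ℕ → ℝ) (h : ℝ → ℝ) (ν : Measure ℝ) : Prop :=
  (∃ g : ℝ → ℝ, ContinuousOn g (Set.Icc 0 1) ∧
    Set.EqOn g (kernelQuantile h ν) (Set.Ioo 0 1)) ∧
  WeightsBounded c 1

/-- Condition (ii): `E|h(X₁)|^p < ∞` and `sup_n C_n(q) < ∞` for some `1 ≤ p < ∞` with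
`1/p + 1/q = 1` (so `q = ∞` if `p = 1`). -/
def ConditionII {Ω : Type*} [MeasurableSpace Ω] (P : Measure Ω) (X : ℕ → Ω → ℝ)
    (c : ℕ → ℕ → ℝ) (h : ℝ → ℝ) : Prop :=
  ∃ p q : ℝ≥0∞, 1 ≤ p ∧ p ≠ ∞ ∧ p⁻¹ + q⁻¹ = 1 ∧
    MemLp (fun ω => h (X 1 ω)) p P ∧ WeightsBounded c q

end LStat

end

/-! Since `⌈n t⌉` is uniform on `{1, …, n}` when `t` is uniform on `(0, 1]`, the L-statistic is an
integral against the same step function that defines the centering: `L_n - μ_n = ∫ c_n(t)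
(h(X_{n:⌈nt⌉}) - h(F⁻¹(t))) dt`. Hölder's inequality and the uniform bound on the `L^q` norm of
`c_n` (`tendsto_lStatistic_sub_centering`) leave one claim: almost surely the second factor tends to
`0` in `L^p(0,1)`, with `p = ∞` under condition (i) and the given `p` under condition (ii).

Both cases rest on a strong law for integrable `f(X_i)` (`strong_law_phiMixing`). Mixing enters only
through variances. The covariance bound `2 √φ ‖f‖₂ ‖g‖₂` makes blocks separated by a gap nearly
orthogonal in `L²`. When the block length doubles from `2^r` to `2^(r+1)`, a gap of length `2^(j+1)`
with `j = r / 3` costs a factor `1 + √φ(2^(j+1))` and a relative error of order `2^(-r/6)`. Both are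
summable in `r`, so variances of sums grow at most linearly (`exists_variance_sum_le`). In Etemadi's
proof this replaces pairwise independence.

Under (ii), empirical quantiles converge at almost every level, which settles bounded continuous
functions by dominated convergence. The function `h` is approximated by such `g` in `L^p` of the
common law, and the strong law for `|h - g|^p` carries the approximation error over to the sample.

Under (i), put `x = X_{n:⌈nt⌉}`. Glivenko–Cantelli places `t` within `δ` of the interval `[F(x-),
F(x)]`. The continuous extension of `H` equals `h(x)` at both ends of that interval for almost every
`x` (`ae_eq_comp_cdf`), and uniform continuity concludes. -/

namespace LStat

/-! ### Covariance inequality for uniformly mixing σ-fields -/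

/-- The integral of a function taking finitely many values. -/
lemma integral_comp_of_finite_range {Ω β : Type*} [MeasurableSpace Ω] {P : Measure Ω}
    [IsFiniteMeasure P] (f : Ω → β) (s : Finset β) (hs : ∀ ω, f ω ∈ s)
    (hf : ∀ b ∈ s, MeasurableSet (f ⁻¹' {b})) (F : β → ℝ) :
    ∫ ω, F (f ω) ∂P = ∑ b ∈ s, F b * P.real (f ⁻¹' {b}) := by
  classical
  have h1 : (fun ω => F (f ω)) = fun ω => ∑ b ∈ s, (f ⁻¹' {b}).indicator (fun _ => F b) ω := by
    ext ω
    rw [Finset.sum_eq_single (f ω)]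
    · simp
    · intro b _ hb
      exact Set.indicator_of_notMem (by simpa using hb.symm) _
    · intro h
      exact absurd (hs ω) h
  rw [h1, integral_finsetSum]
  · refine Finset.sum_congr rfl fun b hb => ?_
    rw [integral_indicator_const _ (hf b hb), smul_eq_mul, mul_comm]
  · intro b hb
    exact (integrable_const _).indicator (hf b hb)

/-- Cauchy–Schwarz for a kernel whose absolute row and column sums are controlled. -/
lemma abs_sum_mul_le_of_row_col {α β : Type*} (s : Finset α) (t : Finset β) (a : α → ℝ)
    (b : β → ℝ) (d : α → β → ℝ) (p : α → ℝ) (q : β → ℝ) (φ : ℝ) (hφ : 0 ≤ φ)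
    (hrow : ∀ i ∈ s, ∑ j ∈ t, |d i j| ≤ 2 * φ * p i)
    (hcol : ∀ j ∈ t, ∑ i ∈ s, |d i j| ≤ 2 * q j) :
    |∑ i ∈ s, ∑ j ∈ t, a i * b j * d i j| ≤
      2 * √φ * √(∑ i ∈ s, a i ^ 2 * p i) * √(∑ j ∈ t, b j ^ 2 * q j) := by
  -- Write `|d| = √|d| · √|d|` and give one factor to each side, so that Cauchy–Schwarz over pairs
  -- produces one row sum and one column sum.
  have h1 : |∑ i ∈ s, ∑ j ∈ t, a i * b j * d i j| ≤
      ∑ x ∈ s ×ˢ t, (|a x.1| * √|d x.1 x.2|) * (|b x.2| * √|d x.1 x.2|) := by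
    rw [Finset.sum_product]
    refine (Finset.abs_sum_le_sum_abs _ _).trans (Finset.sum_le_sum fun i _ => ?_)
    refine (Finset.abs_sum_le_sum_abs _ _).trans (Finset.sum_le_sum fun j _ => ?_)
    rw [abs_mul, abs_mul]
    nth_rewrite 1 [← Real.mul_self_sqrt (abs_nonneg (d i j))]
    exact le_of_eq (by ring)
  have h2 : ∑ x ∈ s ×ˢ t, (|a x.1| * √|d x.1 x.2|) ^ 2 ≤ 2 * φ * ∑ i ∈ s, a i ^ 2 * p i := by
    rw [Finset.sum_product, Finset.mul_sum]
    refine Finset.sum_le_sum fun i hi => ?_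
    have : ∀ j ∈ t, (|a i| * √|d i j|) ^ 2 = a i ^ 2 * |d i j| := fun j _ => by
      rw [mul_pow, sq_abs, Real.sq_sqrt (abs_nonneg _)]
    rw [Finset.sum_congr rfl this, ← Finset.mul_sum]
    calc a i ^ 2 * ∑ j ∈ t, |d i j| ≤ a i ^ 2 * (2 * φ * p i) := by gcongr; exact hrow i hi
      _ = _ := by ring
  have h3 : ∑ x ∈ s ×ˢ t, (|b x.2| * √|d x.1 x.2|) ^ 2 ≤ 2 * ∑ j ∈ t, b j ^ 2 * q j := by
    rw [Finset.sum_product_right, Finset.mul_sum]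
    refine Finset.sum_le_sum fun j hj => ?_
    have : ∀ i ∈ s, (|b j| * √|d i j|) ^ 2 = b j ^ 2 * |d i j| := fun i _ => by
      rw [mul_pow, sq_abs, Real.sq_sqrt (abs_nonneg _)]
    rw [Finset.sum_congr rfl this, ← Finset.mul_sum]
    calc b j ^ 2 * ∑ i ∈ s, |d i j| ≤ b j ^ 2 * (2 * q j) := by gcongr; exact hcol j hj
      _ = _ := by ring
  refine h1.trans ((Real.sum_mul_le_sqrt_mul_sqrt _ _ _).trans ?_)
  calc _ ≤ √(2 * φ * ∑ i ∈ s, a i ^ 2 * p i) * √(2 * ∑ j ∈ t, b j ^ 2 * q j) := by gcongr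
    _ = _ := by
      rw [Real.sqrt_mul (by positivity), Real.sqrt_mul (by norm_num), Real.sqrt_mul (by norm_num)]
      have := Real.mul_self_sqrt (show (0:ℝ) ≤ 2 by norm_num)
      linear_combination (√φ * √(∑ i ∈ s, a i ^ 2 * p i) * √(∑ j ∈ t, b j ^ 2 * q j)) * this

/-- `m₂` is uniformly mixing with respect to `m₁`, with coefficient `φ`. -/
def UniformlyMixing {Ω : Type*} [MeasurableSpace Ω] (P : Measure Ω) (m₁ m₂ : MeasurableSpace Ω)
    (φ : ℝ) : Prop :=
  ∀ A B : Set Ω, MeasurableSet[m₁] A → MeasurableSet[m₂] B →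
    |P.real (A ∩ B) - P.real A * P.real B| ≤ φ * P.real A

section
variable {Ω : Type*} {m₁ m₂ : MeasurableSpace Ω} [mΩ : MeasurableSpace Ω] {P : Measure Ω}
  [IsProbabilityMeasure P] {φ : ℝ}

/-- The covariance is a double sum with kernel `d a b = P(f=a, g=b) - P(f=a) P(g=b)`. In a row, the
`b` of one sign form a single event of `m₂`, so mixing bounds each sign class by `φ P(f=a)`; the two
signs give the factor `2`. In a column the triangle inequality already gives `2 P(g=b)`. Only rows
gain `φ`, hence the square root. -/
lemma UniformlyMixing.abs_cov_simpleFunc_le (hm : UniformlyMixing P m₁ m₂ φ) (h₁ : m₁ ≤ mΩ)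
    (h₂ : m₂ ≤ mΩ) (hφ : 0 ≤ φ) (f : @SimpleFunc Ω m₁ ℝ) (g : @SimpleFunc Ω m₂ ℝ) :
    |∫ ω, f ω * g ω ∂P - (∫ ω, f ω ∂P) * ∫ ω, g ω ∂P| ≤
      2 * √φ * √(∫ ω, f ω ^ 2 ∂P) * √(∫ ω, g ω ^ 2 ∂P) := by
  classical
  set s := @SimpleFunc.range Ω ℝ m₁ f
  set t := @SimpleFunc.range Ω ℝ m₂ g
  have hs : ∀ ω, f ω ∈ s := fun ω => @SimpleFunc.mem_range_self Ω ℝ m₁ f ω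
  have ht : ∀ ω, g ω ∈ t := fun ω => @SimpleFunc.mem_range_self Ω ℝ m₂ g ω
  have hA : ∀ a, MeasurableSet[m₁] (f ⁻¹' {a}) := fun a => @SimpleFunc.measurableSet_fiber Ω ℝ m₁ f a
  have hB : ∀ b, MeasurableSet[m₂] (g ⁻¹' {b}) := fun b => @SimpleFunc.measurableSet_fiber Ω ℝ m₂ g b
  have hAB : ∀ x : ℝ × ℝ, (fun ω => (f ω, g ω)) ⁻¹' {x} = f ⁻¹' {x.1} ∩ g ⁻¹' {x.2} := by
    intro x; ext ω; simp [Prod.ext_iff]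
  have e1 := integral_comp_of_finite_range (P := P) (fun ω => (f ω, g ω)) (s ×ˢ t)
    (fun ω => Finset.mk_mem_product (hs ω) (ht ω))
    (fun x _ => by rw [hAB]; exact (h₁ _ (hA _)).inter (h₂ _ (hB _)))
  have ef := integral_comp_of_finite_range (P := P) f s hs (fun a _ => h₁ _ (hA a))
  have eg := integral_comp_of_finite_range (P := P) g t ht (fun b _ => h₂ _ (hB b))
  set p : ℝ → ℝ := fun a => P.real (f ⁻¹' {a})
  set q : ℝ → ℝ := fun b => P.real (g ⁻¹' {b})
  set r : ℝ → ℝ → ℝ := fun a b => P.real (f ⁻¹' {a} ∩ g ⁻¹' {b})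
  have e2 : ∫ ω, f ω * g ω ∂P - (∫ ω, f ω ∂P) * ∫ ω, g ω ∂P =
      ∑ a ∈ s, ∑ b ∈ t, a * b * (r a b - p a * q b) := by
    rw [e1 (fun x => x.1 * x.2), ef (fun a => a), eg (fun b => b), Finset.sum_mul_sum,
      Finset.sum_product, ← Finset.sum_sub_distrib]
    refine Finset.sum_congr rfl fun a _ => ?_
    rw [← Finset.sum_sub_distrib]
    refine Finset.sum_congr rfl fun b _ => ?_
    rw [hAB]
    ring
  have hsumB : ∀ (A : Set Ω), MeasurableSet A → ∀ t' ⊆ t,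
      ∑ b ∈ t', P.real (A ∩ g ⁻¹' {b}) = P.real (A ∩ g ⁻¹' (t' : Set ℝ)) := by
    intro A hA t' _
    have : A ∩ g ⁻¹' (t' : Set ℝ) = ⋃ b ∈ t', (A ∩ g ⁻¹' {b}) := by
      ext ω; simp
    rw [this, measureReal_biUnion_finset]
    · intro b _ b' _ hbb'
      refine Set.disjoint_left.2 fun ω h1 h2 => hbb' ?_
      exact (h1.2 : g ω = b).symm.trans h2.2
    · exact fun b _ => hA.inter (h₂ _ (hB b))
  have hsumA : ∀ (B : Set Ω), MeasurableSet B →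
      ∑ a ∈ s, P.real (f ⁻¹' {a} ∩ B) = P.real B := by
    intro B hB
    have : B = ⋃ a ∈ s, (f ⁻¹' {a} ∩ B) := by
      ext ω
      have := hs ω
      simp [this]
    conv_rhs => rw [this]
    rw [measureReal_biUnion_finset]
    · intro b _ b' _ hbb'
      refine Set.disjoint_left.2 fun ω h1 h2 => hbb' ?_
      exact (h1.1 : f ω = b).symm.trans h2.1
    · exact fun b _ => (h₁ _ (hA b)).inter hB
  have part : ∀ a, ∀ t' ⊆ t, |∑ b ∈ t', (r a b - p a * q b)| ≤ φ * p a := by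
    intro a t' ht'
    have hB' : MeasurableSet[m₂] (g ⁻¹' (t' : Set ℝ)) := @SimpleFunc.measurableSet_preimage Ω ℝ m₂ g _
    have := hm _ _ (hA a) hB'
    rw [Finset.sum_sub_distrib, ← Finset.mul_sum, hsumB _ (h₁ _ (hA a)) t' ht']
    have h3 := hsumB Set.univ MeasurableSet.univ t' ht'
    simp only [Set.univ_inter] at h3
    rw [h3]
    exact this
  rw [e2, ef (fun a => a ^ 2), eg (fun b => b ^ 2)]
  refine abs_sum_mul_le_of_row_col s t (fun a => a) (fun b => b) _ p q φ hφ ?_ ?_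
  · intro a _
    rw [← Finset.sum_filter_add_sum_filter_not t (fun b => 0 ≤ r a b - p a * q b)]
    have k1 := part a _ (Finset.filter_subset (fun b => 0 ≤ r a b - p a * q b) t)
    have k2 := part a _ (Finset.filter_subset (fun b => ¬ 0 ≤ r a b - p a * q b) t)
    have k3 : ∑ b ∈ t with 0 ≤ r a b - p a * q b, |r a b - p a * q b| =
        ∑ b ∈ t with 0 ≤ r a b - p a * q b, (r a b - p a * q b) :=
      Finset.sum_congr rfl fun b hb => abs_of_nonneg (Finset.mem_filter.1 hb).2
    have k4 : ∑ b ∈ t with ¬ 0 ≤ r a b - p a * q b, |r a b - p a * q b| =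
        -∑ b ∈ t with ¬ 0 ≤ r a b - p a * q b, (r a b - p a * q b) := by
      rw [← Finset.sum_neg_distrib]
      exact Finset.sum_congr rfl fun b hb => abs_of_neg (not_le.1 (Finset.mem_filter.1 hb).2)
    rw [k3, k4]
    linarith [(abs_le.1 k1).2, (abs_le.1 k2).1]
  · intro b _
    calc ∑ a ∈ s, |r a b - p a * q b| ≤ ∑ a ∈ s, (r a b + p a * q b) := by
          refine Finset.sum_le_sum fun a _ => ?_
          have u1 : 0 ≤ r a b := measureReal_nonneg
          have u2 : 0 ≤ p a * q b := mul_nonneg measureReal_nonneg measureReal_nonneg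
          rw [abs_le]; constructor <;> linarith
      _ = 2 * q b := by
          rw [Finset.sum_add_distrib, ← Finset.sum_mul, hsumA _ (h₂ _ (hB b))]
          have := hsumA Set.univ MeasurableSet.univ
          simp only [Set.inter_univ, probReal_univ] at this
          rw [this]; ring

/-- Covariance inequality for bounded variables measurable with respect to two uniformly
mixing `σ`-fields. -/
lemma UniformlyMixing.abs_cov_le (hm : UniformlyMixing P m₁ m₂ φ) (h₁ : m₁ ≤ mΩ)
    (h₂ : m₂ ≤ mΩ) (hφ : 0 ≤ φ) {f g : Ω → ℝ} (hf : Measurable[m₁] f) (hg : Measurable[m₂] g)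
    {K : ℝ} (hfK : ∀ ω, |f ω| ≤ K) (hgK : ∀ ω, |g ω| ≤ K) :
    |∫ ω, f ω * g ω ∂P - (∫ ω, f ω ∂P) * ∫ ω, g ω ∂P| ≤
      2 * √φ * √(∫ ω, f ω ^ 2 ∂P) * √(∫ ω, g ω ^ 2 ∂P) := by
  have hK : 0 ≤ K := by
    obtain ⟨ω⟩ := P.nonempty_of_neZero
    exact (abs_nonneg _).trans (hfK ω)
  have hf' : StronglyMeasurable[m₁] f := hf.stronglyMeasurable
  have hg' : StronglyMeasurable[m₂] g := hg.stronglyMeasurable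
  set F : ℕ → @SimpleFunc Ω m₁ ℝ := fun n => hf'.approxBounded K n
  set G : ℕ → @SimpleFunc Ω m₂ ℝ := fun n => hg'.approxBounded K n
  have hF : ∀ ω, Tendsto (fun n => F n ω) atTop (𝓝 (f ω)) := fun ω =>
    StronglyMeasurable.tendsto_approxBounded_of_norm_le hf' (hfK ω)
  have hG : ∀ ω, Tendsto (fun n => G n ω) atTop (𝓝 (g ω)) := fun ω =>
    StronglyMeasurable.tendsto_approxBounded_of_norm_le hg' (hgK ω)
  have hFK : ∀ n ω, |F n ω| ≤ K := fun n ω => StronglyMeasurable.norm_approxBounded_le hf' hK n ω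
  have hGK : ∀ n ω, |G n ω| ≤ K := fun n ω => StronglyMeasurable.norm_approxBounded_le hg' hK n ω
  have mF : ∀ n, Measurable (F n) := fun n => (@SimpleFunc.measurable Ω ℝ m₁ _ (F n)).mono h₁ le_rfl
  have mG : ∀ n, Measurable (G n) := fun n => (@SimpleFunc.measurable Ω ℝ m₂ _ (G n)).mono h₂ le_rfl
  have key : ∀ (u : ℕ → Ω → ℝ) (v : Ω → ℝ) (C : ℝ), (∀ n, Measurable (u n)) →
      (∀ n ω, |u n ω| ≤ C) → (∀ ω, Tendsto (fun n => u n ω) atTop (𝓝 (v ω))) →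
      Tendsto (fun n => ∫ ω, u n ω ∂P) atTop (𝓝 (∫ ω, v ω ∂P)) := by
    intro u v C hu hC hv
    exact tendsto_integral_of_dominated_convergence (fun _ => C)
      (fun n => (hu n).aestronglyMeasurable) (integrable_const C)
      (fun n => Eventually.of_forall (hC n)) (Eventually.of_forall hv)
  have t1 := key (fun n ω => F n ω * G n ω) (fun ω => f ω * g ω) (K * K)
    (fun n => (mF n).mul (mG n))
    (fun n ω => by rw [abs_mul]; exact mul_le_mul (hFK n ω) (hGK n ω) (abs_nonneg _) hK)
    (fun ω => (hF ω).mul (hG ω))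
  have t2 := key _ f K mF hFK hF
  have t3 := key _ g K mG hGK hG
  have t4 := key (fun n ω => F n ω ^ 2) (fun ω => f ω ^ 2) (K ^ 2) (fun n => (mF n).pow_const 2)
    (fun n ω => by rw [abs_pow]; exact pow_le_pow_left₀ (abs_nonneg _) (hFK n ω) 2)
    (fun ω => (hF ω).pow 2)
  have t5 := key (fun n ω => G n ω ^ 2) (fun ω => g ω ^ 2) (K ^ 2) (fun n => (mG n).pow_const 2)
    (fun n ω => by rw [abs_pow]; exact pow_le_pow_left₀ (abs_nonneg _) (hGK n ω) 2)
    (fun ω => (hG ω).pow 2)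
  refine le_of_tendsto_of_tendsto' (t1.sub (t2.mul t3)).abs
    ((t4.sqrt.const_mul (2 * √φ)).mul t5.sqrt) fun n => ?_
  exact hm.abs_cov_simpleFunc_le h₁ h₂ hφ (F n) (G n)

end

/-! ### Sums of nearly orthogonal vectors -/

lemma sum_range_div_three (u : ℕ → ℝ) (n : ℕ) :
    ∑ j ∈ Finset.range (3 * n), u (j / 3) = 3 * ∑ j ∈ Finset.range n, u j := by
  induction n with
  | zero => simp
  | succ n ih =>
    rw [Nat.mul_succ, Finset.sum_range_succ, Finset.sum_range_succ, Finset.sum_range_succ, ih,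
      Finset.sum_range_succ]
    have h1 : (3 * n) / 3 = n := by omega
    have h2 : (3 * n + 1) / 3 = n := by omega
    have h3 : (3 * n + 2) / 3 = n := by omega
    rw [h1, h2, h3]
    ring

lemma summable_comp_div_three {u : ℕ → ℝ} (hu : ∀ j, 0 ≤ u j) (hs : Summable u) :
    Summable fun j : ℕ => u (j / 3) := by
  refine summable_of_sum_range_le (c := 3 * ∑' j, u j) (fun j => hu _) fun n => ?_
  calc ∑ j ∈ Finset.range n, u (j / 3) ≤ ∑ j ∈ Finset.range (3 * n), u (j / 3) :=
        Finset.sum_le_sum_of_subset_of_nonneg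
          (Finset.range_mono (by omega)) fun _ _ _ => hu _
    _ = 3 * ∑ j ∈ Finset.range n, u j := sum_range_div_three u n
    _ ≤ 3 * ∑' j, u j := by
        gcongr
        exact hs.sum_le_tsum _ fun _ _ => hu _

/-- The terms decay like `2^(j/3 - j/2)`: a gap of length about `2^(j/3)` is negligible against the
norm `2^(j/2)` expected of a block of length `2^j`. -/
lemma summable_gap_ratio :
    Summable fun j : ℕ => (2 : ℝ) ^ (j / 3 + 1) / √2 ^ (j + 1) := by
  have h2 : (1 : ℝ) < √2 := by
    rw [Real.lt_sqrt (by norm_num)]; norm_num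
  have hgeo : Summable fun k : ℕ => 2 * (√2)⁻¹ ^ k :=
    (summable_geometric_of_lt_one (by positivity) (inv_lt_one_of_one_lt₀ h2)).mul_left 2
  refine (summable_comp_div_three (fun _ => by positivity) hgeo).of_nonneg_of_le
    (fun _ => by positivity) fun j => ?_
  have h3 : √2 ^ (3 * (j / 3)) ≤ √2 ^ (j + 1) := pow_le_pow_right₀ h2.le (by omega)
  calc (2 : ℝ) ^ (j / 3 + 1) / √2 ^ (j + 1) ≤ (2 : ℝ) ^ (j / 3 + 1) / √2 ^ (3 * (j / 3)) := by
        gcongr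
    _ = 2 * (√2)⁻¹ ^ (j / 3) := by
        have h4 : √2 ^ (3 * (j / 3)) = 2 ^ (j / 3) * √2 ^ (j / 3) := by
          rw [pow_mul, ← mul_pow]
          congr 1
          have := Real.mul_self_sqrt (show (0:ℝ) ≤ 2 by norm_num)
          linear_combination √2 * this
        rw [h4, pow_succ, inv_pow]
        field_simp

/-- The square is at most `(2 + 4ρ) K² ≤ 2 (1 + ρ)² K²`. The doubling step thus costs the orthogonal
factor `√2` times a factor whose product over all scales converges. -/
lemma norm_add_le_of_inner_le {E : Type*} [NormedAddCommGroup E] [InnerProductSpace ℝ E]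
    {x y : E} {K ρ : ℝ} (hρ : 0 ≤ ρ) (hx : ‖x‖ ≤ K) (hy : ‖y‖ ≤ K)
    (h : inner ℝ x y ≤ 2 * ρ * ‖x‖ * ‖y‖) : ‖x + y‖ ≤ √2 * (1 + ρ) * K := by
  have hK : 0 ≤ K := (norm_nonneg _).trans hx
  refine le_of_sq_le_sq ?_ (by positivity)
  have h1 : ‖x + y‖ ^ 2 = ‖x‖ ^ 2 + 2 * inner ℝ x y + ‖y‖ ^ 2 := norm_add_sq_real x y
  have h2 : 2 * ρ * ‖x‖ * ‖y‖ ≤ 2 * ρ * K * K := by gcongr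
  have h3 : ‖x‖ ^ 2 ≤ K ^ 2 := pow_le_pow_left₀ (norm_nonneg _) hx 2
  have h4 : ‖y‖ ^ 2 ≤ K ^ 2 := pow_le_pow_left₀ (norm_nonneg _) hy 2
  have h5 : (√2 * (1 + ρ) * K) ^ 2 = 2 * (1 + ρ) ^ 2 * K ^ 2 := by
    rw [mul_pow, mul_pow, Real.sq_sqrt (by norm_num)]
  rw [h1, h5]
  nlinarith [mul_nonneg (sq_nonneg ρ) (sq_nonneg K)]

open Finset in
/-- In an inner product space, sums of `n` vectors whose blocks separated by a gap `2 ^ (j + 1)`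
are almost orthogonal, up to a summable error `ρ j`, have norm `O(√n)`. -/
lemma exists_norm_sum_le_sqrt {E : Type*} [NormedAddCommGroup E] [InnerProductSpace ℝ E]
    {ρ : ℕ → ℝ} (hρ : ∀ j, 0 ≤ ρ j) (hs : Summable ρ) :
    ∃ D : ℝ, 0 ≤ D ∧ ∀ (z : ℕ → E) (v : ℝ), (∀ i, ‖z i‖ ≤ v) →
      (∀ j a m l, inner ℝ (∑ i ∈ Ico a (a + m), z i)
          (∑ i ∈ Ico (a + m + 2 ^ (j + 1)) (a + m + 2 ^ (j + 1) + l), z i) ≤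
        2 * ρ j * ‖∑ i ∈ Ico a (a + m), z i‖ *
          ‖∑ i ∈ Ico (a + m + 2 ^ (j + 1)) (a + m + 2 ^ (j + 1) + l), z i‖) →
      ∀ n : ℕ, ‖∑ i ∈ range n, z i‖ ≤ D * v * √n := by
  set b : ℕ → ℝ := fun j => (2 : ℝ) ^ (j / 3 + 1) / √2 ^ (j + 1)
  have hb : ∀ j, 0 ≤ b j := fun j => by positivity
  have sρ := summable_comp_div_three hρ hs
  -- An explicit supersolution of the doubling recursion `(1 + ρ(r/3)) A_r + b_r ≤ A_{r+1}`, bounded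
  -- because `ρ (j / 3)` and `b j` are summable.
  set A : ℕ → ℝ := fun r => Real.exp (∑ j ∈ range r, ρ (j / 3)) * (1 + ∑ j ∈ range r, b j)
  set M : ℝ := Real.exp (∑' j : ℕ, ρ (j / 3)) * (1 + ∑' j, b j)
  have hAM : ∀ r, A r ≤ M := fun r => by
    have h1 := sρ.sum_le_tsum (range r) (fun _ _ => hρ _)
    have h2 := summable_gap_ratio.sum_le_tsum (range r) (fun j _ => hb j)
    have h3 : 0 ≤ ∑ j ∈ range r, b j := sum_nonneg fun j _ => hb j
    have h4 := Real.exp_le_exp.2 h1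
    exact mul_le_mul h4 (by linarith) (by linarith) (Real.exp_pos _).le
  have hA1 : ∀ r, 0 ≤ A r := fun r => by
    have h3 : 0 ≤ ∑ j ∈ range r, b j := sum_nonneg fun j _ => hb j
    positivity
  have hAstep : ∀ r, (1 + ρ (r / 3)) * A r + b r ≤ A (r + 1) := fun r => by
    have h3 : 0 ≤ ∑ j ∈ range r, b j := sum_nonneg fun j _ => hb j
    have h4 : 0 ≤ ∑ j ∈ range (r + 1), ρ (j / 3) := sum_nonneg fun j _ => hρ _
    have h5 : 1 + ρ (r / 3) ≤ Real.exp (ρ (r / 3)) := by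
      rw [add_comm]; exact Real.add_one_le_exp _
    have h6 : b r ≤ Real.exp (∑ j ∈ range (r + 1), ρ (j / 3)) * b r :=
      le_mul_of_one_le_left (hb r) (Real.one_le_exp h4)
    have h7 : (1 + ρ (r / 3)) * A r ≤
        Real.exp (∑ j ∈ range (r + 1), ρ (j / 3)) * (1 + ∑ j ∈ range r, b j) := by
      simp only [A]
      rw [sum_range_succ, Real.exp_add, ← mul_assoc, mul_comm (Real.exp (∑ j ∈ range r, ρ (j / 3)))]
      gcongr
    simp only [A] at h7 ⊢
    rw [sum_range_succ b, ← add_assoc, mul_add _ (1 + ∑ j ∈ range r, b j)]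
    linarith
  -- The factor `√2` pays for rounding `n` up to a power of two, which is at most `2 n`.
  refine ⟨M * √2, mul_nonneg ((hA1 0).trans (hAM 0)) (Real.sqrt_nonneg 2), ?_⟩
  intro z v hz hcov
  have hv : 0 ≤ v := (norm_nonneg _).trans (hz 0)
  have triv : ∀ a m : ℕ, ‖∑ i ∈ Ico a (a + m), z i‖ ≤ m * v := fun a m => by
    refine (norm_sum_le _ _).trans ((sum_le_sum fun i _ => hz i).trans ?_)
    simp
  have main : ∀ r a n, n ≤ 2 ^ r → ‖∑ i ∈ Ico a (a + n), z i‖ ≤ v * √2 ^ r * A r := by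
    intro r
    induction r with
    | zero =>
      intro a n hn
      have h0 : A 0 = 1 := by simp [A]
      rw [h0, pow_zero, mul_one, mul_one]
      refine (triv a n).trans ?_
      have : (n : ℝ) ≤ 1 := by exact_mod_cast hn
      nlinarith
    | succ r ih =>
      intro a n hn
      obtain ⟨g, hg⟩ : ∃ g : ℕ, g = 2 ^ (r / 3 + 1) := ⟨_, rfl⟩
      obtain ⟨m₁, m₂, hm₁, hm₂, rfl⟩ : ∃ m₁ m₂, m₁ ≤ 2 ^ r ∧ m₂ ≤ 2 ^ r ∧ n = m₁ + m₂ :=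
        ⟨n / 2, n - n / 2, by rw [pow_succ] at hn; omega, by rw [pow_succ] at hn; omega, by omega⟩
      -- The gap is cut from the start of the second half. If `g ≥ m₂`, truncated subtraction makes
      -- the far block empty and the gap absorbs the whole half.
      have split : ∑ i ∈ Ico a (a + (m₁ + m₂)), z i = (∑ i ∈ Ico a (a + m₁), z i +
          ∑ i ∈ Ico (a + m₁ + g) (a + m₁ + g + (m₂ - g)), z i) +
          ∑ i ∈ Ico (a + m₁) (a + m₁ + min g m₂), z i := by
        rw [← sum_Ico_consecutive z (show a ≤ a + m₁ by omega)
          (show a + m₁ ≤ a + (m₁ + m₂) by omega), add_assoc]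
        congr 1
        rcases le_total g m₂ with h | h
        · rw [min_eq_left h, add_comm (∑ i ∈ Ico (a + m₁ + g) _, z i), ← sum_Ico_consecutive z (show a + m₁ ≤ a + m₁ + g by omega)
            (show a + m₁ + g ≤ a + (m₁ + m₂) by omega)]
          congr 2
          congr 1
          omega
        · rw [min_eq_right h, Nat.sub_eq_zero_of_le h]
          simp [add_assoc]
      set x := ∑ i ∈ Ico a (a + m₁), z i with hx
      set y := ∑ i ∈ Ico (a + m₁ + g) (a + m₁ + g + (m₂ - g)), z i with hy
      set K := v * √2 ^ r * A r with hK
      have hxK : ‖x‖ ≤ K := ih a m₁ hm₁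
      have hyK : ‖y‖ ≤ K := ih _ _ ((Nat.sub_le _ _).trans hm₂)
      have hK0 : 0 ≤ K := (norm_nonneg _).trans hxK
      have hxy : ‖x + y‖ ≤ √2 * (1 + ρ (r / 3)) * K := by
        have h3 := hcov (r / 3) a m₁ (m₂ - g)
        rw [← hg] at h3
        exact norm_add_le_of_inner_le (hρ _) hxK hyK h3
      have hmin : ‖∑ i ∈ Ico (a + m₁) (a + m₁ + min g m₂), z i‖ ≤ 2 ^ (r / 3 + 1) * v := by
        refine (triv _ _).trans ?_
        gcongr
        calc ((min g m₂ : ℕ) : ℝ) ≤ (g : ℕ) := by exact_mod_cast min_le_left _ _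
          _ = _ := by rw [hg]; push_cast; rfl
      rw [split]
      calc _ ≤ √2 * (1 + ρ (r / 3)) * K + 2 ^ (r / 3 + 1) * v :=
            (norm_add_le _ _).trans (add_le_add hxy hmin)
        _ = v * √2 ^ (r + 1) * ((1 + ρ (r / 3)) * A r + b r) := by
            simp only [hK, b]
            field_simp
            ring
        _ ≤ _ := by
            gcongr
            exact hAstep r
  intro n
  rcases Nat.eq_zero_or_pos n with rfl | hn
  · simp
  have h1 : n ≤ 2 ^ Nat.clog 2 n := Nat.le_pow_clog (by norm_num) n
  have h2 : 2 ^ Nat.clog 2 n ≤ 2 * n := by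
    rcases Nat.lt_or_ge n 2 with h | h
    · have : n = 1 := by omega
      subst this; simp
    · have := Nat.pow_pred_clog_lt_self (b := 2) (by norm_num) h
      have h3 : 0 < Nat.clog 2 n := Nat.clog_pos (by norm_num) h
      obtain ⟨k, hk⟩ : ∃ k, Nat.clog 2 n = k + 1 := ⟨Nat.clog 2 n - 1, by omega⟩
      rw [hk] at this ⊢
      rw [pow_succ]
      simp only [Nat.pred_succ] at this
      omega
  have h3 := main (Nat.clog 2 n) 0 n h1
  rw [zero_add, ← range_eq_Ico] at h3
  refine h3.trans ?_
  have h4 : √2 ^ Nat.clog 2 n ≤ √2 * √n := by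
    rw [← Real.sqrt_mul (by norm_num)]
    refine Real.le_sqrt_of_sq_le ?_
    rw [← pow_mul, mul_comm, pow_mul, Real.sq_sqrt (by norm_num)]
    exact_mod_cast h2
  calc v * √2 ^ Nat.clog 2 n * A (Nat.clog 2 n) ≤ v * (√2 * √n) * M := by
        gcongr
        exact hAM _
    _ = _ := by ring

/-! ### Mixing coefficients and the variance of partial sums -/

lemma measurable_sigmaField {Ω : Type*} {X : ℕ → Ω → ℝ} {I : Set ℕ} {i : ℕ} (hi : i ∈ I) :
    Measurable[sigmaField X I] (X i) :=
  Measurable.of_comap_le (le_iSup₂_of_le i hi le_rfl)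

section
variable {Ω : Type*} [MeasurableSpace Ω] {P : Measure Ω} {X : ℕ → Ω → ℝ}

lemma phiCoeff_nonneg (n : ℕ) : 0 ≤ phiCoeff P X n := by
  refine Real.sSup_nonneg ?_
  rintro _ ⟨_, _, _, _, _, _, _, rfl⟩
  exact abs_nonneg _

lemma sigmaField_le (hX : ∀ i, 1 ≤ i → Measurable (X i)) {I : Set ℕ} (hI : ∀ i ∈ I, 1 ≤ i) :
    sigmaField X I ≤ (inferInstance : MeasurableSpace Ω) :=
  iSup₂_le fun i hi => (hX i (hI i hi)).comap_le

variable [IsProbabilityMeasure P]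

lemma uniformlyMixing_phiCoeff (hX : ∀ i, 1 ≤ i → Measurable (X i)) {k : ℕ} (hk : 1 ≤ k) (n : ℕ) :
    UniformlyMixing P (sigmaField X (Set.Icc 1 k)) (sigmaField X (Set.Ici (k + n)))
      (phiCoeff P X n) := by
  intro A B hA hB
  have hA' : MeasurableSet A := sigmaField_le hX (fun i hi => hi.1) _ hA
  rcases eq_or_ne (P A) 0 with h0 | h0
  · have h1 : P.real A = 0 := by simp [measureReal_def, h0]
    have h2 : P.real (A ∩ B) = 0 := by
      simp [measureReal_def, measure_mono_null Set.inter_subset_left h0]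
    simp [h1, h2]
  · have hpos : 0 < P.real A := by
      rw [measureReal_def]; exact ENNReal.toReal_pos h0 (measure_ne_top _ _)
    have hle : |(ProbabilityTheory.cond P A).real B - P.real B| ≤ phiCoeff P X n := by
      -- A real supremum bounds its members only if the set is bounded above; here differences of
      -- probabilities are at most `1`.
      refine le_csSup ⟨1, ?_⟩ ⟨k, hk, A, B, hA, hB, pos_iff_ne_zero.2 h0, rfl⟩
      rintro _ ⟨_, _, A', B', _, _, hA'', rfl⟩
      have := cond_isProbabilityMeasure hA''.ne'
      have h1 : (ProbabilityTheory.cond P A').real B' ≤ 1 := measureReal_le_one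
      have h2 : 0 ≤ (ProbabilityTheory.cond P A').real B' := measureReal_nonneg
      have h3 : P.real B' ≤ 1 := measureReal_le_one
      have h4 : 0 ≤ P.real B' := measureReal_nonneg
      rw [abs_le]; constructor <;> linarith
    have e : (ProbabilityTheory.cond P A).real B = (P.real A)⁻¹ * P.real (A ∩ B) := by
      rw [measureReal_def, cond_apply hA', ENNReal.toReal_mul, ENNReal.toReal_inv]
      rfl
    have e2 : P.real (A ∩ B) - P.real A * P.real B =
        P.real A * ((ProbabilityTheory.cond P A).real B - P.real B) := by
      rw [e]; field_simp
    rw [e2, abs_mul, abs_of_pos hpos, mul_comm]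
    gcongr

lemma memLp_of_bounded {f : Ω → ℝ} (hf : Measurable f) {K : ℝ} (hK : ∀ ω, |f ω| ≤ K) (p : ℝ≥0∞) :
    MemLp f p P :=
  MemLp.of_bound hf.aestronglyMeasurable K (Eventually.of_forall hK)

open Finset in
/-- Variance bound for partial sums of bounded functions of a uniformly mixing sequence. -/
lemma exists_variance_sum_le (hX : ∀ i, 1 ≤ i → Measurable (X i))
    (hsum : Summable fun n : ℕ => √(phiCoeff P X (2 ^ (n + 1)))) :
    ∃ D : ℝ, 0 ≤ D ∧ ∀ (g : ℕ → ℝ → ℝ) (K : ℕ → ℝ) (V : ℝ) (n : ℕ), (∀ i, Measurable (g i)) →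
      (∀ i x, |g i x| ≤ K i) → 0 ≤ V → (∀ i < n, Var[fun ω => g i (X (i + 1) ω); P] ≤ V) →
      Var[fun ω => ∑ i ∈ range n, g i (X (i + 1) ω); P] ≤ D * n * V := by
  obtain ⟨D, hD, hDz⟩ := exists_norm_sum_le_sqrt (E := Lp ℝ 2 P) (fun _ => Real.sqrt_nonneg _) hsum
  refine ⟨D ^ 2, by positivity, ?_⟩
  intro g K V n hg hK hV hvar
  -- Centered, and set to zero from index `n` on, since the Hilbert space lemma needs one norm bound
  -- for all indices while `V` controls only `i < n`.
  set Y : ℕ → Ω → ℝ := fun i ω =>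
    if i < n then g i (X (i + 1) ω) - ∫ ω', g i (X (i + 1) ω') ∂P else 0 with hY
  have mX : ∀ i, Measurable fun ω => g i (X (i + 1) ω) := fun i => (hg i).comp (hX _ (by omega))
  have bX : ∀ i ω, |g i (X (i + 1) ω)| ≤ K i := fun i ω => hK i _
  have iX : ∀ i, Integrable (fun ω => g i (X (i + 1) ω)) P := fun i =>
    (memLp_of_bounded (mX i) (bX i) 1).integrable le_rfl
  have bI : ∀ i, |∫ ω', g i (X (i + 1) ω') ∂P| ≤ K i := fun i => by
    have := norm_integral_le_of_norm_le_const (μ := P) (f := fun ω => g i (X (i + 1) ω))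
      (Eventually.of_forall (bX i))
    simpa using this
  have K0 : ∀ i, 0 ≤ K i := fun i => (abs_nonneg _).trans (hK i 0)
  have bY : ∀ i ω, |Y i ω| ≤ 2 * K i := fun i ω => by
    simp only [hY]
    split_ifs
    · refine (abs_sub _ _).trans ?_
      linarith [bX i ω, bI i]
    · simpa using K0 i
  have mYI : ∀ (I : Set ℕ) i, i + 1 ∈ I → Measurable[sigmaField X I] (Y i) := fun I i hi => by
    simp only [hY]
    split_ifs
    · exact ((hg i).comp (measurable_sigmaField hi)).sub_const _
    · exact measurable_const
  have mY : ∀ i, Measurable (Y i) := fun i => by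
    simp only [hY]
    split_ifs
    · exact (mX i).sub_const _
    · exact measurable_const
  have lY : ∀ i, MemLp (Y i) 2 P := fun i => memLp_of_bounded (mY i) (bY i) 2
  have cY : ∀ i, ∫ ω, Y i ω ∂P = 0 := fun i => by
    simp only [hY]
    split_ifs
    · rw [integral_sub (iX i) (integrable_const _)]; simp
    · simp
  have cS : ∀ s : Finset ℕ, ∫ ω, ∑ i ∈ s, Y i ω ∂P = 0 := fun s => by
    rw [integral_finsetSum _ fun i _ => (lY i).integrable (by norm_num)]
    simp [cY]
  set z : ℕ → Lp ℝ 2 P := fun i => (lY i).toLp (Y i)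
  have ez : ∀ s : Finset ℕ, (∑ i ∈ s, z i : Lp ℝ 2 P) =ᵐ[P] fun ω => ∑ i ∈ s, Y i ω := fun s => by
    have h1 : ∀ᵐ ω ∂P, ∀ i, z i ω = Y i ω := ae_all_iff.2 fun i => (lY i).coeFn_toLp
    filter_upwards [Lp.coeFn_finsetSum s z, h1] with ω h2 h3
    rw [h2, Finset.sum_apply]
    exact sum_congr rfl fun i _ => h3 i
  have inn : ∀ s t : Finset ℕ, inner ℝ (∑ i ∈ s, z i) (∑ i ∈ t, z i) =
      ∫ ω, (∑ i ∈ s, Y i ω) * (∑ i ∈ t, Y i ω) ∂P := fun s t => by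
    rw [L2.inner_def]
    refine integral_congr_ae ?_
    filter_upwards [ez s, ez t] with ω h1 h2
    rw [h1, h2]
    simp [mul_comm]
  have nor : ∀ s : Finset ℕ, ‖∑ i ∈ s, z i‖ = √(∫ ω, (∑ i ∈ s, Y i ω) ^ 2 ∂P) := fun s => by
    rw [norm_eq_sqrt_real_inner, inn]
    simp_rw [sq]
  have varY : ∀ i < n, ∫ ω, Y i ω ^ 2 ∂P = Var[fun ω => g i (X (i + 1) ω); P] := fun i hi => by
    rw [variance_eq_integral (mX i).aemeasurable]
    simp [hY, hi]
  have nz : ∀ i, ‖z i‖ ≤ √V := fun i => by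
    have := nor {i}
    simp only [sum_singleton] at this
    rw [this]
    refine Real.sqrt_le_sqrt ?_
    by_cases hi : i < n
    · rw [varY i hi]; exact hvar i hi
    · simpa [hY, hi] using hV
  have hfin := hDz z (√V) nz ?_ n
  · rw [nor] at hfin
    have e1 : Var[fun ω => ∑ i ∈ range n, g i (X (i + 1) ω); P] =
        ∫ ω, (∑ i ∈ range n, Y i ω) ^ 2 ∂P := by
      rw [variance_eq_integral (Finset.measurable_sum _ fun i _ => mX i).aemeasurable,
        integral_finsetSum _ fun i _ => iX i]
      refine integral_congr_ae (Eventually.of_forall fun ω => ?_)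
      simp only
      rw [← sum_sub_distrib]
      congr 1
      refine sum_congr rfl fun i hi => ?_
      simp [hY, mem_range.1 hi]
    have h0 : 0 ≤ ∫ ω, (∑ i ∈ range n, Y i ω) ^ 2 ∂P := integral_nonneg fun ω => sq_nonneg _
    rw [e1, ← Real.sq_sqrt h0]
    calc √(∫ ω, (∑ i ∈ range n, Y i ω) ^ 2 ∂P) ^ 2 ≤ (D * √V * √n) ^ 2 :=
          pow_le_pow_left₀ (Real.sqrt_nonneg _) hfin 2
      _ = D ^ 2 * n * V := by
          rw [mul_pow, mul_pow, Real.sq_sqrt hV, Real.sq_sqrt (Nat.cast_nonneg _)]; ring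
  · intro j a m l
    rw [inn, nor, nor]
    set s := Ico a (a + m)
    set t := Ico (a + m + 2 ^ (j + 1)) (a + m + 2 ^ (j + 1) + l)
    -- The past ends at `X_k` with `k = a + m`, because `Y i` depends on `X (i + 1)`; the mixing
    -- coefficient requires `k ≥ 1`, and for `k = 0` the first block is empty.
    rcases Nat.eq_zero_or_pos (a + m) with h0 | h0
    · have : s = ∅ := by simp only [s]; rw [h0]; simp
      simp [this]
    have bS : ∀ s' : Finset ℕ, ∀ ω, |∑ i ∈ s', Y i ω| ≤ ∑ i ∈ s', 2 * K i := fun s' ω =>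
      (abs_sum_le_sum_abs _ _).trans (sum_le_sum fun i _ => bY i ω)
    have b0 : ∀ s' : Finset ℕ, 0 ≤ ∑ i ∈ s', 2 * K i := fun s' =>
      sum_nonneg fun i _ => by have := K0 i; positivity
    have h := (uniformlyMixing_phiCoeff (P := P) hX h0 (2 ^ (j + 1))).abs_cov_le
      (sigmaField_le hX fun i hi => hi.1)
      (sigmaField_le hX fun i hi =>
        (Nat.succ_le_of_lt h0).trans ((Nat.le_add_right _ _).trans (Set.mem_Ici.1 hi)))
      (phiCoeff_nonneg _) (f := fun ω => ∑ i ∈ s, Y i ω) (g := fun ω => ∑ i ∈ t, Y i ω)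
      (Finset.measurable_sum _ fun i hi => mYI _ i (by
        have := mem_Ico.1 hi; exact ⟨by omega, by omega⟩))
      (Finset.measurable_sum _ fun i hi => mYI _ i (by
        have := mem_Ico.1 hi; exact Set.mem_Ici.2 (by omega)))
      (K := ∑ i ∈ s, 2 * K i + ∑ i ∈ t, 2 * K i)
      (fun ω => (bS s ω).trans (by linarith [b0 t])) (fun ω => (bS t ω).trans (by linarith [b0 s]))
    rw [cS, zero_mul, sub_zero] at h
    exact (le_abs_self _).trans h

end

/-! ### Strong law of large numbers -/

lemma mul_sum_inv_pow_filter_le {c : ℝ} (hc : 1 < c) {x : ℝ} (hx : 0 ≤ x) (N : ℕ) :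
    x * ∑ i ∈ Finset.range N with x ≤ c ^ i, c⁻¹ ^ i ≤ (1 - c⁻¹)⁻¹ := by
  have hc0 : 0 < c := by linarith
  have hc1 : c⁻¹ < 1 := inv_lt_one_of_one_lt₀ hc
  have hpos : 0 < 1 - c⁻¹ := by linarith
  rcases Finset.eq_empty_or_nonempty {i ∈ Finset.range N | x ≤ c ^ i} with h | h
  · rw [h]; simp [hpos.le]
  · set k := Finset.min' _ h
    have hk : x ≤ c ^ k := (Finset.mem_filter.1 (Finset.min'_mem _ h)).2
    have hsub : {i ∈ Finset.range N | x ≤ c ^ i} ⊆ Finset.Ico k N := fun i hi =>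
      Finset.mem_Ico.2 ⟨Finset.min'_le _ i hi, Finset.mem_range.1 (Finset.mem_filter.1 hi).1⟩
    calc x * ∑ i ∈ Finset.range N with x ≤ c ^ i, c⁻¹ ^ i ≤ x * (c⁻¹ ^ k / (1 - c⁻¹)) := by
          gcongr
          exact (Finset.sum_le_sum_of_subset_of_nonneg hsub fun _ _ _ => by positivity).trans
            (geom_sum_Ico_le_of_lt_one (by positivity) hc1)
      _ ≤ c ^ k * (c⁻¹ ^ k / (1 - c⁻¹)) := by gcongr
      _ = (1 - c⁻¹)⁻¹ := by
          rw [inv_pow]; field_simp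

/-- Only indices with `f ω ≤ c ^ i` contribute, and the geometric tail from the first of them is of
order `1 / f ω`. Integrated, this makes the Chebyshev bounds along `⌊c ^ i⌋₊` summable from a first
moment alone. -/
lemma sum_inv_mul_truncation_sq_le {α : Type*} {f : α → ℝ} {ω : α} (hf : 0 ≤ f ω) {c : ℝ}
    (hc : 1 < c) (N : ℕ) :
    ∑ i ∈ Finset.range N, (⌊c ^ i⌋₊ : ℝ)⁻¹ * truncation f ⌊c ^ i⌋₊ ω ^ 2 ≤
      (1 - c⁻¹)⁻¹ ^ 2 * f ω := by
  have hc0 : 0 < c := by linarith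
  have hc1 : c⁻¹ < 1 := inv_lt_one_of_one_lt₀ hc
  have hpos : 0 < 1 - c⁻¹ := by linarith
  calc ∑ i ∈ Finset.range N, (⌊c ^ i⌋₊ : ℝ)⁻¹ * truncation f ⌊c ^ i⌋₊ ω ^ 2
      ≤ ∑ i ∈ Finset.range N, if f ω ≤ c ^ i then (1 - c⁻¹)⁻¹ * f ω ^ 2 * c⁻¹ ^ i else 0 := by
        refine Finset.sum_le_sum fun i _ => ?_
        have hfl : (⌊c ^ i⌋₊ : ℝ) ≤ c ^ i := Nat.floor_le (by positivity)
        have hfl' := mul_pow_le_nat_floor_pow hc i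
        split_ifs with h
        · have h1 : (⌊c ^ i⌋₊ : ℝ)⁻¹ ≤ (1 - c⁻¹)⁻¹ * c⁻¹ ^ i := by
            rw [inv_pow, ← mul_inv]
            exact inv_anti₀ (by positivity) hfl'
          have h2 : truncation f ⌊c ^ i⌋₊ ω ^ 2 ≤ f ω ^ 2 :=
            sq_le_sq.2 (abs_truncation_le_abs_self f _ ω)
          calc _ ≤ ((1 - c⁻¹)⁻¹ * c⁻¹ ^ i) * f ω ^ 2 := by gcongr
            _ = _ := by ring
        · have : truncation f ⌊c ^ i⌋₊ ω = 0 := by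
            simp only [truncation, Function.comp_apply]
            refine Set.indicator_of_notMem (fun h' => h ?_) _
            exact h'.2.trans hfl
          simp [this]
    _ = (1 - c⁻¹)⁻¹ * f ω * (f ω * ∑ i ∈ Finset.range N with f ω ≤ c ^ i, c⁻¹ ^ i) := by
        rw [← Finset.sum_filter, ← Finset.mul_sum]
        ring
    _ ≤ (1 - c⁻¹)⁻¹ * f ω * (1 - c⁻¹)⁻¹ := by
        gcongr
        exact mul_sum_inv_pow_filter_le hc hf N
    _ = _ := by ring

section
variable {Ω : Type*} [mΩ : MeasurableSpace Ω] {μ : Measure Ω} [IsProbabilityMeasure μ]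

open Finset in
/-- Etemadi's argument: truncated partial sums with linearly growing variance concentrate along
geometric subsequences. -/
lemma ae_eventually_abs_sum_truncation_sub_lt {Y : ℕ → Ω → ℝ} (hint : Integrable (Y 0) μ)
    (hident : ∀ i, IdentDistrib (Y i) (Y 0) μ μ) (hnonneg : ∀ i ω, 0 ≤ Y i ω) {D : ℝ} (hD : 0 ≤ D)
    (hvar : ∀ n : ℕ, Var[fun ω => ∑ i ∈ range n, truncation (Y i) i ω; μ] ≤
      D * n * ∫ ω, truncation (Y 0) n ω ^ 2 ∂μ)
    {c : ℝ} (hc : 1 < c) {ε : ℝ} (hε : 0 < ε) :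
    ∀ᵐ ω ∂μ, ∀ᶠ n : ℕ in atTop,
      |∑ i ∈ range ⌊c ^ n⌋₊, truncation (Y i) i ω -
        ∫ ω', ∑ i ∈ range ⌊c ^ n⌋₊, truncation (Y i) i ω' ∂μ| < ε * ⌊c ^ n⌋₊ := by
  set u : ℕ → ℕ := fun n => ⌊c ^ n⌋₊
  set S : ℕ → Ω → ℝ := fun n ω => ∑ i ∈ range n, truncation (Y i) i ω
  have upos : ∀ n, (0 : ℝ) < u n := fun n =>
    zero_lt_one.trans_le (by
      simp only [u, Nat.one_le_cast, Nat.one_le_floor_iff, one_le_pow₀ hc.le])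
  have hsq : ∀ A : ℝ, Integrable (fun ω => truncation (Y 0) A ω ^ 2) μ := fun A =>
    (hint.1.memLp_truncation (p := 2)).integrable_sq
  set C : ℝ := D * ((1 - c⁻¹)⁻¹ ^ 2 * ∫ ω, Y 0 ω ∂μ)
  have I2 : ∀ N, ∑ i ∈ range N, ((u i : ℝ) ^ 2)⁻¹ * Var[S (u i); μ] ≤ C := by
    intro N
    calc ∑ i ∈ range N, ((u i : ℝ) ^ 2)⁻¹ * Var[S (u i); μ]
        ≤ ∑ i ∈ range N, D * ∫ ω, (u i : ℝ)⁻¹ * truncation (Y 0) (u i) ω ^ 2 ∂μ := by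
          refine sum_le_sum fun i _ => ?_
          rw [integral_const_mul]
          calc _ ≤ ((u i : ℝ) ^ 2)⁻¹ * (D * u i * ∫ ω, truncation (Y 0) (u i) ω ^ 2 ∂μ) := by
                gcongr
                exact hvar (u i)
            _ = _ := by
                have := (upos i).ne'
                field_simp
      _ = D * ∫ ω, ∑ i ∈ range N, (u i : ℝ)⁻¹ * truncation (Y 0) (u i) ω ^ 2 ∂μ := by
          rw [← mul_sum, integral_finsetSum _ fun i _ => (hsq _).const_mul _]
      _ ≤ C := by
          simp only [C]
          rw [← integral_const_mul ((1 - c⁻¹)⁻¹ ^ 2)]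
          refine mul_le_mul_of_nonneg_left (integral_mono
            (integrable_finsetSum _ fun i _ => (hsq _).const_mul _) (hint.const_mul _)
            fun ω => sum_inv_mul_truncation_sq_le (hnonneg 0 ω) hc N) hD
  have I3 : ∀ N, ∑ i ∈ range N, μ {ω | (u i * ε : ℝ) ≤ |S (u i) ω - ∫ ω', S (u i) ω' ∂μ|} ≤
      ENNReal.ofReal (ε⁻¹ ^ 2 * C) := by
    intro N
    calc
      ∑ i ∈ range N, μ {ω | (u i * ε : ℝ) ≤ |S (u i) ω - ∫ ω', S (u i) ω' ∂μ|} ≤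
          ∑ i ∈ range N, ENNReal.ofReal (Var[S (u i); μ] / (u i * ε) ^ 2) := by
        gcongr with i _
        apply meas_ge_le_variance_div_sq
        · exact memLp_finsetSum _ fun j _ => (hident j).aestronglyMeasurable_fst.memLp_truncation
        · exact mul_pos (upos i) hε
      _ = ENNReal.ofReal (∑ i ∈ range N, Var[S (u i); μ] / (u i * ε) ^ 2) := by
        rw [ENNReal.ofReal_sum_of_nonneg fun i _ => ?_]
        exact div_nonneg (variance_nonneg _ _) (sq_nonneg _)
      _ ≤ ENNReal.ofReal (ε⁻¹ ^ 2 * C) := by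
        apply ENNReal.ofReal_le_ofReal
        simp_rw [div_eq_inv_mul, ← inv_pow, mul_inv, mul_comm _ (ε⁻¹), mul_pow, mul_assoc,
          ← mul_sum]
        gcongr
        simpa only [inv_pow] using I2 N
  have I4 : (∑' i, μ {ω | (u i * ε : ℝ) ≤ |S (u i) ω - ∫ ω', S (u i) ω' ∂μ|}) < ∞ :=
    (le_of_tendsto_of_tendsto' (ENNReal.tendsto_nat_tsum _) tendsto_const_nhds I3).trans_lt
      ENNReal.ofReal_lt_top
  filter_upwards [ae_eventually_notMem I4.ne] with ω hω
  filter_upwards [hω] with n hn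
  rw [mul_comm]
  exact not_le.1 hn

open Finset Asymptotics in
/-- Strong law of large numbers for nonnegative identically distributed variables whose truncated
partial sums have linearly growing variance. -/
lemma strong_law_of_variance_sum_truncation_le {Y : ℕ → Ω → ℝ} (hint : Integrable (Y 0) μ)
    (hident : ∀ i, IdentDistrib (Y i) (Y 0) μ μ) (hnonneg : ∀ i ω, 0 ≤ Y i ω) {D : ℝ} (hD : 0 ≤ D)
    (hvar : ∀ n : ℕ, Var[fun ω => ∑ i ∈ range n, truncation (Y i) i ω; μ] ≤
      D * n * ∫ ω, truncation (Y 0) n ω ^ 2 ∂μ) :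
    ∀ᵐ ω ∂μ, Tendsto (fun n : ℕ => (∑ i ∈ range n, Y i ω) / n) atTop (𝓝 (∫ ω', Y 0 ω' ∂μ)) := by
  obtain ⟨c, -, cone, clim⟩ :
      ∃ c : ℕ → ℝ, StrictAnti c ∧ (∀ n : ℕ, 1 < c n) ∧ Tendsto c atTop (𝓝 1) :=
    exists_seq_strictAnti_tendsto (1 : ℝ)
  obtain ⟨v, -, v_pos, v_lim⟩ :
      ∃ v : ℕ → ℝ, StrictAnti v ∧ (∀ n : ℕ, 0 < v n) ∧ Tendsto v atTop (𝓝 0) :=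
    exists_seq_strictAnti_tendsto (0 : ℝ)
  let _ : MeasureSpace Ω := { mΩ with volume := μ }
  have h1 : ∀ᵐ ω ∂μ, ∀ k i, ∀ᶠ n : ℕ in atTop,
      |∑ i ∈ range ⌊c k ^ n⌋₊, truncation (Y i) i ω -
        ∫ ω', ∑ i ∈ range ⌊c k ^ n⌋₊, truncation (Y i) i ω' ∂μ| < v i * ⌊c k ^ n⌋₊ :=
    ae_all_iff.2 fun k => ae_all_iff.2 fun i =>
      ae_eventually_abs_sum_truncation_sub_lt hint hident hnonneg hD hvar (cone k) (v_pos i)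
  -- Removing the truncation, in mean here and almost surely in `h5`, uses identical distribution
  -- and integrability but no independence.
  have h3 : (fun n : ℕ => (∫ ω', ∑ i ∈ range n, truncation (Y i) i ω' ∂μ) - n * ∫ ω', Y 0 ω' ∂μ)
      =o[atTop] fun n : ℕ => (n : ℝ) := by
    have := strong_law_aux3 Y hint hident
    simp only [Finset.sum_apply] at this
    exact this
  have h5 : ∀ᵐ ω ∂μ, (fun n : ℕ => ∑ i ∈ range n, truncation (Y i) i ω - ∑ i ∈ range n, Y i ω)
      =o[atTop] fun n : ℕ => (n : ℝ) := strong_law_aux5 Y hint hident hnonneg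
  filter_upwards [h1, h5] with ω hω h'ω
  refine tendsto_div_of_monotone_of_tendsto_div_floor_pow _ _ ?_ c cone clim fun k => ?_
  · intro m n hmn
    exact sum_le_sum_of_subset_of_nonneg (range_mono hmn) fun i _ _ => hnonneg i ω
  · have A : Tendsto (fun n : ℕ => ⌊c k ^ n⌋₊) atTop atTop :=
      tendsto_nat_floor_atTop.comp (tendsto_pow_atTop_atTop_of_one_lt (cone k))
    have h2 : (fun n : ℕ => ∑ i ∈ range ⌊c k ^ n⌋₊, truncation (Y i) i ω -
        ∫ ω', ∑ i ∈ range ⌊c k ^ n⌋₊, truncation (Y i) i ω' ∂μ) =o[atTop]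
        fun n : ℕ => (⌊c k ^ n⌋₊ : ℝ) := by
      refine isLittleO_iff.2 fun ε εpos => ?_
      obtain ⟨i, hi⟩ : ∃ i, v i < ε := ((tendsto_order.1 v_lim).2 ε εpos).exists
      filter_upwards [hω k i] with n hn
      simp only [Real.norm_eq_abs, Nat.abs_cast]
      exact hn.le.trans (mul_le_mul_of_nonneg_right hi.le (Nat.cast_nonneg _))
    have L : (fun n : ℕ => ∑ i ∈ range ⌊c k ^ n⌋₊, Y i ω - ⌊c k ^ n⌋₊ * ∫ ω', Y 0 ω' ∂μ)
        =o[atTop] fun n => (⌊c k ^ n⌋₊ : ℝ) := by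
      refine ((h2.add (h3.comp_tendsto A)).sub (h'ω.comp_tendsto A)).congr_left fun n => ?_
      simp only [Function.comp_apply]
      ring
    rw [← tendsto_sub_nhds_zero_iff]
    refine L.tendsto_div_nhds_zero.congr fun n => ?_
    have : (0 : ℝ) < ⌊c k ^ n⌋₊ := zero_lt_one.trans_le (by
      simp only [Nat.one_le_cast, Nat.one_le_floor_iff, one_le_pow₀ (cone k).le])
    field_simp

variable {X : ℕ → Ω → ℝ}

open Finset in
lemma strong_law_phiMixing_of_nonneg (hX : ∀ i, 1 ≤ i → Measurable (X i))
    (hident : ∀ i, 1 ≤ i → IdentDistrib (X i) (X 1) μ μ)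
    (hsum : Summable fun n : ℕ => √(phiCoeff μ X (2 ^ (n + 1))))
    {f : ℝ → ℝ} (hf : Measurable f) (hf0 : ∀ x, 0 ≤ f x)
    (hint : Integrable (fun ω => f (X 1 ω)) μ) :
    ∀ᵐ ω ∂μ, Tendsto (fun n : ℕ => (∑ i ∈ range n, f (X (i + 1) ω)) / n) atTop
      (𝓝 (∫ ω', f (X 1 ω') ∂μ)) := by
  obtain ⟨D, hD, hDv⟩ := exists_variance_sum_le hX hsum
  have hid : ∀ i, IdentDistrib (fun ω => f (X (i + 1) ω)) (fun ω => f (X (0 + 1) ω)) μ μ :=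
    fun i => (hident (i + 1) (by omega)).comp hf
  refine strong_law_of_variance_sum_truncation_le (Y := fun i ω => f (X (i + 1) ω)) hint hid
    (fun i ω => hf0 _) hD fun n => ?_
  -- The common bound `V` is the second moment of the truncation at level `n`. It dominates those at
  -- levels `i < n` because truncating a nonnegative variable is monotone in the level.
  refine hDv (fun i => truncation f i) (fun i => i) _ n ?_ ?_ ?_ ?_
  · intro i
    exact (measurable_id.indicator measurableSet_Ioc).comp hf
  · intro i x
    simpa using abs_truncation_le_bound f i x
  · exact integral_nonneg fun ω => sq_nonneg _
  · intro i hi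
    have h1 : IdentDistrib (truncation (fun ω => f (X (i + 1) ω)) i)
      (truncation (fun ω => f (X (0 + 1) ω)) i) μ μ := (hid i).truncation
    have h2 := h1.variance_eq
    change Var[truncation (fun ω => f (X (i + 1) ω)) i; μ] ≤ _
    rw [h2]
    refine (variance_le_expectation_sq hint.1.truncation).trans ?_
    refine integral_mono (hint.1.memLp_truncation (p := 2)).integrable_sq
      (hint.1.memLp_truncation (p := 2)).integrable_sq fun ω => ?_
    have hin : (i : ℝ) ≤ n := by exact_mod_cast hi.le
    have hh := hf0 (X (0 + 1) ω)
    simp only [truncation, Function.comp_apply, Set.indicator_apply, Set.mem_Ioc, id, Pi.pow_apply]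
    split_ifs with k1 k2
    · rfl
    · exact absurd ⟨by linarith [k1.1], by linarith [k1.2]⟩ k2
    · exact pow_le_pow_left₀ le_rfl hh 2
    · rfl

open Finset in
/-- Strong law of large numbers for functions of an identically distributed uniformly mixing
sequence. -/
lemma strong_law_phiMixing (hX : ∀ i, 1 ≤ i → Measurable (X i))
    (hident : ∀ i, 1 ≤ i → IdentDistrib (X i) (X 1) μ μ)
    (hsum : Summable fun n : ℕ => √(phiCoeff μ X (2 ^ (n + 1))))
    {f : ℝ → ℝ} (hf : Measurable f) (hint : Integrable (fun ω => f (X 1 ω)) μ) :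
    ∀ᵐ ω ∂μ, Tendsto (fun n : ℕ => (∑ i ∈ range n, f (X (i + 1) ω)) / n) atTop
      (𝓝 (∫ ω', f (X 1 ω') ∂μ)) := by
  filter_upwards [strong_law_phiMixing_of_nonneg hX hident hsum (f := fun x => max (f x) 0)
      (hf.max measurable_const) (fun x => le_max_right _ _) hint.pos_part,
    strong_law_phiMixing_of_nonneg hX hident hsum (f := fun x => max (-f x) 0)
      (hf.neg.max measurable_const) (fun x => le_max_right _ _) hint.neg_part] with ω h1 h2
  have h3 := h1.sub h2
  rw [← integral_sub hint.pos_part hint.neg_part] at h3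
  simpa only [← sub_div, ← sum_sub_distrib, max_zero_sub_max_neg_zero_eq_self] using h3

end

/-! ### Quantile function and quantile transform -/

section Quantile
variable (ν : Measure ℝ)

/-- Right continuity of the distribution function makes the infimum attained, which gives a Galois
connection. -/
lemma quantile_le_iff {t : ℝ} (ht : t ∈ Set.Ioo (0 : ℝ) 1) {x : ℝ} :
    quantile ν t ≤ x ↔ t ≤ cdf ν x := by
  have hne : {x : ℝ | t ≤ cdf ν x}.Nonempty := by
    obtain ⟨y, hy⟩ := ((tendsto_cdf_atTop ν).eventually (lt_mem_nhds ht.2)).exists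
    exact ⟨y, hy.le⟩
  have hbdd : BddBelow {x : ℝ | t ≤ cdf ν x} := by
    obtain ⟨y, hy⟩ := ((tendsto_cdf_atBot ν).eventually (gt_mem_nhds ht.1)).exists
    refine ⟨y, fun z hz => ?_⟩
    by_contra hlt
    exact absurd (hz.trans (monotone_cdf ν (not_le.1 hlt).le)) (not_le.2 hy)
  refine ⟨fun h => ?_, fun h => csInf_le hbdd h⟩
  have hq : t ≤ cdf ν (quantile ν t) := by
    have hr := ((cdf ν).right_continuous (quantile ν t)).mono Set.Ioi_subset_Ici_self
    refine ge_of_tendsto hr ?_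
    filter_upwards [self_mem_nhdsWithin] with y hy
    obtain ⟨z, hz, hzy⟩ := exists_lt_of_csInf_lt hne hy
    exact le_trans hz (monotone_cdf ν hzy.le)
  exact hq.trans (monotone_cdf ν h)

lemma monotoneOn_quantile : MonotoneOn (quantile ν) (Set.Ioo 0 1) := fun _ hs _ ht hst =>
  (quantile_le_iff ν hs).2 (hst.trans ((quantile_le_iff ν ht).1 le_rfl))

/-- The uniform distribution on `(0, 1]`. -/
noncomputable abbrev unif : Measure ℝ := volume.restrict (Set.Ioc (0 : ℝ) 1)

instance : IsProbabilityMeasure unif := ⟨by simp⟩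

lemma ae_unif_mem_Ioo : ∀ᵐ t ∂unif, t ∈ Set.Ioo (0 : ℝ) 1 := by
  rw [unif, ← restrict_Ioo_eq_restrict_Ioc]
  exact ae_restrict_mem measurableSet_Ioo

lemma aemeasurable_quantile : AEMeasurable (quantile ν) unif := by
  rw [unif, ← restrict_Ioo_eq_restrict_Ioc]
  exact aemeasurable_restrict_of_monotoneOn measurableSet_Ioo (monotoneOn_quantile ν)

variable [IsProbabilityMeasure ν]

/-- The quantile transform. -/
lemma map_quantile : unif.map (quantile ν) = ν := by
  have : IsProbabilityMeasure (unif.map (quantile ν)) :=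
    Measure.isProbabilityMeasure_map (aemeasurable_quantile ν)
  refine Measure.ext_of_Iic _ _ fun x => ?_
  rw [Measure.map_apply_of_aemeasurable (aemeasurable_quantile ν) measurableSet_Iic,
    ← ofReal_cdf]
  have h1 : quantile ν ⁻¹' Set.Iic x =ᵐ[unif] Set.Iic (cdf ν x) := by
    filter_upwards [ae_unif_mem_Ioo] with t ht
    exact propext (quantile_le_iff ν ht)
  rw [measure_congr h1, Measure.restrict_apply measurableSet_Iic, Set.inter_comm,
    Set.Ioc_inter_Iic, min_eq_right (cdf_le_one ν x), Real.volume_Ioc, sub_zero]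

lemma measureReal_Iio_quantile_le {t : ℝ} (ht : t ∈ Set.Ioo (0 : ℝ) 1) :
    ν.real (Set.Iio (quantile ν t)) ≤ t := by
  have h1 : ν (Set.Iio (quantile ν t)) ≤ ENNReal.ofReal t := by
    nth_rewrite 1 [← map_quantile ν]
    rw [Measure.map_apply_of_aemeasurable (aemeasurable_quantile ν) measurableSet_Iio]
    have h2 : quantile ν ⁻¹' Set.Iio (quantile ν t) ≤ᵐ[unif] Set.Iic t := by
      filter_upwards [ae_unif_mem_Ioo] with s hs
      intro hlt
      by_contra hst
      exact absurd (monotoneOn_quantile ν ht hs (not_le.1 hst).le) (not_le.2 hlt)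
    refine (measure_mono_ae h2).trans ?_
    rw [Measure.restrict_apply measurableSet_Iic, Set.inter_comm, Set.Ioc_inter_Iic,
      min_eq_right ht.2.le, Real.volume_Ioc, sub_zero]
  rw [measureReal_def]
  exact ENNReal.toReal_le_of_le_ofReal ht.1.le h1

lemma cdf_le_measureReal_Iio {x y : ℝ} (h : x < y) : cdf ν x ≤ ν.real (Set.Iio y) := by
  rw [cdf_eq_real]
  exact measureReal_mono (Set.Iic_subset_Iio.2 h)

/-- A jump of `F` at `x` is a flat piece of `F⁻¹`. -/
lemma quantile_eq_of_mem_Ioc {t x : ℝ} (ht : t ∈ Set.Ioo (0 : ℝ) 1)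
    (h : t ∈ Set.Ioc (ν.real (Set.Iio x)) (cdf ν x)) : quantile ν t = x := by
  refine le_antisymm ((quantile_le_iff ν ht).2 h.2) ?_
  by_contra hlt
  obtain ⟨y, hy1, hy2⟩ := exists_between (not_le.1 hlt)
  have h1 := (quantile_le_iff ν ht).1 hy1.le
  exact absurd (h1.trans (cdf_le_measureReal_Iio ν hy2)) (not_le.2 h.1)

/-- If `H` extends continuously to `G`, then `h` is almost everywhere recovered from `G` at both
one-sided limits of the distribution function. -/
lemma ae_eq_comp_cdf {h : ℝ → ℝ} (hh : Measurable h) {G : ℝ → ℝ} (hG : Continuous G)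
    (hGH : Set.EqOn G (kernelQuantile h ν) (Set.Ioo 0 1)) :
    ∀ᵐ x ∂ν, G (cdf ν x) = h x ∧ G (ν.real (Set.Iio x)) = h x := by
  have m1 : Measurable fun x => cdf ν x := (monotone_cdf ν).measurable
  have m2 : Measurable fun x => ν.real (Set.Iio x) :=
    Monotone.measurable fun a b hab => measureReal_mono (Set.Iio_subset_Iio hab)
  have hms : MeasurableSet {x | G (cdf ν x) = h x ∧ G (ν.real (Set.Iio x)) = h x} :=
    (measurableSet_eq_fun (hG.measurable.comp m1) hh).inter
      (measurableSet_eq_fun (hG.measurable.comp m2) hh)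
  have key : ∀ᵐ t ∂unif, G (cdf ν (quantile ν t)) = h (quantile ν t) ∧
      G (ν.real (Set.Iio (quantile ν t))) = h (quantile ν t) := by
    filter_upwards [ae_unif_mem_Ioo] with t ht
    set x := quantile ν t with hx
    have ha : ν.real (Set.Iio x) ≤ t := measureReal_Iio_quantile_le ν ht
    have hb : t ≤ cdf ν x := (quantile_le_iff ν ht).1 le_rfl
    rcases (ha.trans hb).eq_or_lt with hab | hab
    · have e1 : ν.real (Set.Iio x) = t := le_antisymm ha (hab ▸ hb)
      have e2 : cdf ν x = t := hab ▸ e1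
      rw [e1, e2]
      exact ⟨hGH ht, hGH ht⟩
    -- At an atom, `G` is constant on the open jump interval and by continuity on its closure, whose
    -- ends may be `0` or `1`.
    · have hc : Set.EqOn G (fun _ => h x) (Set.Icc (ν.real (Set.Iio x)) (cdf ν x)) := by
        rw [← closure_Ioo hab.ne]
        refine Set.EqOn.closure ?_ hG continuous_const
        intro s hs
        have hs' : s ∈ Set.Ioo (0 : ℝ) 1 :=
          ⟨measureReal_nonneg.trans_lt hs.1, hs.2.trans_le (cdf_le_one ν x)⟩
        have := hGH hs'
        simp only [kernelQuantile] at this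
        rw [this, quantile_eq_of_mem_Ioc ν hs' ⟨hs.1, hs.2.le⟩]
      exact ⟨hc ⟨hab.le, le_rfl⟩, hc ⟨le_rfl, hab.le⟩⟩
  have := (ae_map_iff (aemeasurable_quantile ν) hms).2 key
  rwa [map_quantile] at this

end Quantile

/-! ### Step functions of `⌈n t⌉` -/

section Step

lemma ceil_mul_mem {n : ℕ} (hn : 1 ≤ n) {t : ℝ} (ht : t ∈ Set.Ioc (0 : ℝ) 1) :
    1 ≤ ⌈(n : ℝ) * t⌉₊ ∧ ⌈(n : ℝ) * t⌉₊ ≤ n := by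
  have hn' : (0 : ℝ) < n := by exact_mod_cast hn
  refine ⟨Nat.one_le_iff_ne_zero.2 (Nat.ceil_pos.2 (mul_pos hn' ht.1)).ne', Nat.ceil_le.2 ?_⟩
  nlinarith [ht.2]

/-- Under the uniform distribution, `⌈n t⌉` is uniformly distributed on `{1, …, n}`. -/
lemma map_ceil_mul {n : ℕ} (hn : 1 ≤ n) :
    unif.map (fun t : ℝ => ⌈(n : ℝ) * t⌉₊) =
      (n : ℝ≥0∞)⁻¹ • ∑ i : Fin n, Measure.dirac ((i : ℕ) + 1) := by
  have hn' : (0 : ℝ) < n := by exact_mod_cast hn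
  have hm : Measurable (fun t : ℝ => ⌈(n : ℝ) * t⌉₊) :=
    Nat.measurable_ceil.comp (measurable_const_mul _)
  refine Measure.ext_of_singleton fun k => ?_
  rw [Measure.map_apply hm (measurableSet_singleton k), Measure.restrict_apply
    (hm (measurableSet_singleton k))]
  simp only [Measure.smul_apply, Measure.finsetSum_apply, smul_eq_mul]
  by_cases hk : 1 ≤ k ∧ k ≤ n
  · have e : (fun t : ℝ => ⌈(n : ℝ) * t⌉₊) ⁻¹' {k} ∩ Set.Ioc (0 : ℝ) 1 =
        Set.Ioc (((k : ℝ) - 1) / n) (k / n) := by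
      ext t
      simp only [Set.mem_inter_iff, Set.mem_preimage, Set.mem_singleton_iff, Set.mem_Ioc]
      rw [Nat.ceil_eq_iff (by omega), Nat.cast_sub hk.1, Nat.cast_one, div_lt_iff₀ hn',
        le_div_iff₀ hn', mul_comm t]
      refine ⟨fun h => h.1, fun h => ⟨h, ?_, ?_⟩⟩
      · have : (1 : ℝ) ≤ k := by exact_mod_cast hk.1
        by_contra hneg
        nlinarith
      · have : (k : ℝ) ≤ n := by exact_mod_cast hk.2
        by_contra hneg
        nlinarith
    rw [e, Real.volume_Ioc, Finset.sum_eq_single (⟨k - 1, by omega⟩ : Fin n)]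
    · have h1 : (k : ℝ) / n - ((k : ℝ) - 1) / n = (n : ℝ)⁻¹ := by field_simp; ring
      rw [h1, ENNReal.ofReal_inv_of_pos hn', ENNReal.ofReal_natCast]
      have : k - 1 + 1 = k := by omega
      simp [this]
    · intro i _ hi
      have : (i : ℕ) + 1 ≠ k := fun h => hi (Fin.ext (by simp; omega))
      simp [this]
    · simp
  · have e : (fun t : ℝ => ⌈(n : ℝ) * t⌉₊) ⁻¹' {k} ∩ Set.Ioc (0 : ℝ) 1 = ∅ := by
      ext t
      simp only [Set.mem_inter_iff, Set.mem_preimage, Set.mem_singleton_iff,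
        Set.mem_empty_iff_false, iff_false, not_and]
      rintro rfl ht
      exact hk (ceil_mul_mem hn ht)
    rw [e, measure_empty, Finset.sum_eq_zero, mul_zero]
    intro i _
    have : (i : ℕ) + 1 ≠ k := fun h => hk (by omega)
    simp [this]

lemma aemeasurable_ceil_mul (n : ℕ) : AEMeasurable (fun t : ℝ => ⌈(n : ℝ) * t⌉₊) unif :=
  (Nat.measurable_ceil.comp (measurable_const_mul _)).aemeasurable

variable {n : ℕ} (hn : 1 ≤ n)
include hn

lemma integrable_comp_ceil (Φ : ℕ → ℝ) : Integrable (fun t : ℝ => Φ ⌈(n : ℝ) * t⌉₊) unif := by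
  have h : Integrable Φ (unif.map (fun t : ℝ => ⌈(n : ℝ) * t⌉₊)) := by
    rw [map_ceil_mul hn]
    refine Integrable.smul_measure ?_ (ENNReal.inv_ne_top.2 (by simp; omega))
    exact integrable_finsetSum_measure.2 fun i _ => integrable_dirac (by simp)
  exact h.comp_aemeasurable (aemeasurable_ceil_mul n)

lemma integral_comp_ceil (Φ : ℕ → ℝ) :
    ∫ t, Φ ⌈(n : ℝ) * t⌉₊ ∂unif = (n : ℝ)⁻¹ * ∑ i : Fin n, Φ (i + 1) := by
  rw [← integral_map (aemeasurable_ceil_mul n) (f := Φ) Measurable.of_discrete.aestronglyMeasurable,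
    map_ceil_mul hn, integral_smul_measure,
    integral_finsetSum_measure fun i _ => integrable_dirac (by simp)]
  simp

end Step

/-! ### Order statistics as empirical quantiles -/

section OrderStat
variable {Ω : Type*} (X : ℕ → Ω → ℝ) (n : ℕ) (ω : Ω)

/-- The empirical quantile function at level `k / n`. -/
noncomputable def rankStat (k : ℕ) : ℝ :=
  if h : k - 1 < n then orderStat X n ⟨k - 1, h⟩ ω else 0

lemma rankStat_succ (i : Fin n) : rankStat X n ω (i + 1) = orderStat X n i ω := by
  simp [rankStat]

/-- The empirical mean of `f`. -/
noncomputable def empMean (f : ℝ → ℝ) : ℝ := (∑ i ∈ Finset.range n, f (X (i + 1) ω)) / n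

lemma sum_comp_orderStat (f : ℝ → ℝ) :
    (n : ℝ)⁻¹ * ∑ i : Fin n, f (orderStat X n i ω) = empMean X n ω f := by
  rw [empMean, Finset.sum_range, div_eq_inv_mul]
  congr 1
  exact Equiv.sum_comp (Tuple.sort fun j : Fin n => X (j + 1) ω) fun i : Fin n => f (X (i + 1) ω)

lemma empMean_indicator (s : Set ℝ) [DecidablePred (· ∈ s)] :
    empMean X n ω (s.indicator 1) =
      (Finset.univ.filter fun i : Fin n => orderStat X n i ω ∈ s).card / n := by
  rw [← sum_comp_orderStat, Finset.card_filter, div_eq_inv_mul]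
  push_cast
  congr 1
  refine Finset.sum_congr rfl fun i _ => ?_
  simp [Set.indicator_apply]

lemma monotone_orderStat : Monotone fun i => orderStat X n i ω :=
  Tuple.monotone_sort fun j : Fin n => X (j + 1) ω

variable {n} {t : ℝ} (hn : 1 ≤ n) (ht : t ∈ Set.Ioc (0 : ℝ) 1)
include hn ht

lemma rankStat_ceil_eq : ∃ i : Fin n, (i : ℕ) + 1 = ⌈(n : ℝ) * t⌉₊ ∧
    rankStat X n ω ⌈(n : ℝ) * t⌉₊ = orderStat X n i ω := by
  obtain ⟨h1, h2⟩ := ceil_mul_mem hn ht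
  refine ⟨⟨⌈(n : ℝ) * t⌉₊ - 1, by omega⟩, by simp; omega, ?_⟩
  rw [rankStat, dif_pos]

/-- The order statistic of rank `⌈n t⌉` is at most `y` exactly when at least `n t` observations are:
the empirical counterpart of `quantile_le_iff`. -/
lemma rankStat_ceil_le_iff (y : ℝ) :
    rankStat X n ω ⌈(n : ℝ) * t⌉₊ ≤ y ↔ t ≤ empMean X n ω ((Set.Iic y).indicator 1) := by
  classical
  have hn' : (0 : ℝ) < n := by exact_mod_cast hn
  obtain ⟨i, hi, e⟩ := rankStat_ceil_eq X ω hn ht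
  rw [e, ← Tuple.lt_card_le_iff_apply_le_of_monotone (monotone_orderStat X n ω),
    empMean_indicator, le_div_iff₀ hn', mul_comm t, ← Nat.ceil_le, ← hi, Nat.succ_le_iff]
  rfl

lemma rankStat_ceil_lt_iff (y : ℝ) :
    rankStat X n ω ⌈(n : ℝ) * t⌉₊ < y ↔ t ≤ empMean X n ω ((Set.Iio y).indicator 1) := by
  classical
  have hn' : (0 : ℝ) < n := by exact_mod_cast hn
  obtain ⟨i, hi, e⟩ := rankStat_ceil_eq X ω hn ht
  rw [e, ← Tuple.lt_card_lt_iff_apply_lt_of_monotone (monotone_orderStat X n ω),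
    empMean_indicator, le_div_iff₀ hn', mul_comm t, ← Nat.ceil_le, ← hi, Nat.succ_le_iff]
  rfl

lemma exists_rankStat_ceil_eq : ∃ j, 1 ≤ j ∧ rankStat X n ω ⌈(n : ℝ) * t⌉₊ = X j ω := by
  obtain ⟨i, _, e⟩ := rankStat_ceil_eq X ω hn ht
  exact ⟨_, Nat.succ_pos _, e⟩

end OrderStat

/-! ### Glivenko–Cantelli and convergence along empirical quantiles -/

section Empirical
variable {Ω : Type*} {X : ℕ → Ω → ℝ} {ω : Ω} (ν : Measure ℝ)

lemma empMean_mono {f g : ℝ → ℝ} (hfg : ∀ x, f x ≤ g x) (n : ℕ) :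
    empMean X n ω f ≤ empMean X n ω g :=
  div_le_div_of_nonneg_right (Finset.sum_le_sum fun _ _ => hfg _) (Nat.cast_nonneg n)

lemma empMean_indicator_mono {s t : Set ℝ} (hst : s ⊆ t) (n : ℕ) :
    empMean X n ω (s.indicator 1) ≤ empMean X n ω (t.indicator 1) :=
  empMean_mono (fun _ => Set.indicator_le_indicator_of_subset hst (fun _ => zero_le_one) _) n

lemma empMean_indicator_nonneg (s : Set ℝ) (n : ℕ) : 0 ≤ empMean X n ω (s.indicator 1) :=
  div_nonneg (Finset.sum_nonneg fun _ _ => Set.indicator_nonneg (fun _ _ => zero_le_one) _)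
    (Nat.cast_nonneg n)

lemma empMean_indicator_le_one (s : Set ℝ) (n : ℕ) : empMean X n ω (s.indicator 1) ≤ 1 := by
  refine (empMean_indicator_mono (Set.subset_univ s) n).trans ?_
  simp only [empMean, Set.indicator_univ, Pi.one_apply, Finset.sum_const, Finset.card_range,
    nsmul_eq_mul, mul_one]
  exact div_self_le_one _

/-- Glivenko–Cantelli, from pointwise convergence at the quantiles of rational levels. -/
lemma eventually_forall_empMean_close [IsProbabilityMeasure ν]
    (hIic : ∀ r : ℚ, Tendsto (fun n => empMean X n ω ((Set.Iic (quantile ν r)).indicator 1)) atTop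
      (𝓝 (cdf ν (quantile ν r))))
    (hIio : ∀ r : ℚ, Tendsto (fun n => empMean X n ω ((Set.Iio (quantile ν r)).indicator 1)) atTop
      (𝓝 (ν.real (Set.Iio (quantile ν r))))) {δ : ℝ} (hδ : 0 < δ) :
    ∀ᶠ n in atTop, ∀ x, empMean X n ω ((Set.Iic x).indicator 1) ≤ cdf ν x + δ ∧
      ν.real (Set.Iio x) - δ ≤ empMean X n ω ((Set.Iio x).indicator 1) := by
  obtain ⟨k, hk⟩ := exists_nat_one_div_lt (half_pos hδ)
  set m : ℕ := k + 1 with hm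
  have hm0 : (0 : ℝ) < m := by positivity
  have hmd : 1 / (m : ℝ) < δ / 2 := by simpa [hm] using hk
  have hev : ∀ᶠ n in atTop, ∀ j ∈ Finset.range m,
      cdf ν (quantile ν ((j : ℚ) / m : ℚ)) - δ / 2 <
        empMean X n ω ((Set.Iic (quantile ν ((j : ℚ) / m : ℚ))).indicator 1) ∧
      empMean X n ω ((Set.Iio (quantile ν ((j : ℚ) / m : ℚ))).indicator 1) <
        ν.real (Set.Iio (quantile ν ((j : ℚ) / m : ℚ))) + δ / 2 := by
    refine (Finset.range m).eventually_all.2 fun j _ => ?_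
    exact ((hIic _).eventually (lt_mem_nhds (by linarith))).and
      ((hIio _).eventually (gt_mem_nhds (by linarith)))
  filter_upwards [hev] with n hn x
  have hmem : ∀ j : ℕ, 0 < j → j < m → (j : ℝ) / m ∈ Set.Ioo (0 : ℝ) 1 := fun j h0 h1 =>
    ⟨by positivity, (div_lt_one hm0).2 (by exact_mod_cast h1)⟩
  constructor
  · have hF0 : 0 ≤ cdf ν x := cdf_nonneg ν x
    -- The first grid level strictly above `F(x)`: its quantile lies to the right of `x`, so only
    -- the strict empirical frequency there is needed.
    set j := ⌊(m : ℝ) * cdf ν x⌋₊ + 1 with hj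
    have h1 : cdf ν x < (j : ℝ) / m := by
      rw [lt_div_iff₀ hm0, mul_comm, hj]; push_cast; exact Nat.lt_floor_add_one _
    have h2 : (j : ℝ) / m ≤ cdf ν x + 1 / m := by
      rw [div_le_iff₀ hm0, add_mul, one_div, inv_mul_cancel₀ hm0.ne', mul_comm (cdf ν x), hj]
      push_cast
      linarith [Nat.floor_le (mul_nonneg hm0.le hF0)]
    by_cases hjm : j < m
    · have hmem' := hmem j (by omega) hjm
      have h3 := (hn j (Finset.mem_range.2 hjm)).2
      push_cast at h3
      have h4 : x < quantile ν ((j : ℝ) / m) := by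
        by_contra hle
        exact absurd ((quantile_le_iff ν hmem').1 (not_lt.1 hle)) (not_le.2 h1)
      have h5 := empMean_indicator_mono (X := X) (ω := ω) (Set.Iic_subset_Iio.2 h4) n
      linarith [measureReal_Iio_quantile_le ν hmem']
    · have h3 : (1 : ℝ) ≤ (j : ℝ) / m := by
        rw [le_div_iff₀ hm0, one_mul]; exact_mod_cast not_lt.1 hjm
      linarith [empMean_indicator_le_one (X := X) (ω := ω) (Set.Iic x) n]
  · set a := ν.real (Set.Iio x) with ha
    have ha1 : a ≤ 1 := measureReal_le_one
    have ha0 : 0 ≤ a := measureReal_nonneg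
    set i := ⌈(m : ℝ) * a⌉₊ with hi
    have h1 : a ≤ (i : ℝ) / m := by
      rw [le_div_iff₀ hm0, mul_comm]; exact Nat.le_ceil _
    have h2 : (i : ℝ) / m < a + 1 / m := by
      rw [div_lt_iff₀ hm0, add_mul, one_div, inv_mul_cancel₀ hm0.ne', mul_comm a]
      exact Nat.ceil_lt_add_one (mul_nonneg hm0.le ha0)
    have him : i ≤ m := Nat.ceil_le.2 (by nlinarith)
    by_cases hi1 : i ≤ 1
    · have : (i : ℝ) / m ≤ 1 / m := by
        gcongr; exact_mod_cast hi1
      linarith [empMean_indicator_nonneg (X := X) (ω := ω) (Set.Iio x) n]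
    -- The level `j / m` is the last one strictly below `F(x-)`, so its quantile lies to the left of
    -- `x`.
    · obtain ⟨j, hj⟩ : ∃ j, i = j + 1 := ⟨i - 1, by omega⟩
      have hij : (i : ℝ) / m = (j : ℝ) / m + 1 / m := by rw [hj]; push_cast; ring
      have hmem' := hmem j (by omega) (by omega)
      have h3 := (hn j (Finset.mem_range.2 (by omega))).1
      push_cast at h3
      have h4 : quantile ν ((j : ℝ) / m) < x := by
        by_contra hle
        have h5 : a ≤ ν.real (Set.Iio (quantile ν ((j : ℝ) / m))) :=
          measureReal_mono (Set.Iio_subset_Iio (not_lt.1 hle))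
        linarith [measureReal_Iio_quantile_le ν hmem']
      have h5 := empMean_indicator_mono (X := X) (ω := ω) (Set.Iic_subset_Iio.2 h4) n
      linarith [(quantile_le_iff ν hmem').1 le_rfl]

/-- Empirical quantiles converge at continuity points of the quantile function. -/
lemma tendsto_rankStat_quantile
    (hrat : ∀ r : ℚ, Tendsto (fun n => empMean X n ω ((Set.Iic (r : ℝ)).indicator 1)) atTop
      (𝓝 (cdf ν r))) {t : ℝ} (ht : t ∈ Set.Ioo (0 : ℝ) 1)
    (hc : ContinuousWithinAt (quantile ν) (Set.Ioo 0 1) t) :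
    Tendsto (fun n : ℕ => rankStat X n ω ⌈(n : ℝ) * t⌉₊) atTop (𝓝 (quantile ν t)) := by
  have ht' : t ∈ Set.Ioc (0 : ℝ) 1 := ⟨ht.1, ht.2.le⟩
  refine tendsto_order.2 ⟨fun a ha => ?_, fun b hb => ?_⟩
  · obtain ⟨r, hr1, hr2⟩ := exists_rat_btwn ha
    have h1 : cdf ν r < t := not_le.1 fun h => absurd ((quantile_le_iff ν ht).2 h) (not_le.2 hr2)
    filter_upwards [(hrat r).eventually (gt_mem_nhds h1), eventually_ge_atTop 1] with n hn hn1
    refine hr1.trans (not_le.1 fun h => ?_)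
    exact absurd ((rankStat_ceil_le_iff X ω hn1 ht' r).1 h) (not_le.2 hn)
  · obtain ⟨r, hr1, hr2⟩ := exists_rat_btwn hb
    -- Continuity at `t` serves only the upper bound: a level `s > t` with quantile below `r` forces
    -- `F(r) > t` strictly.
    have h1 : ∀ᶠ s in 𝓝[>] t, quantile ν s < r := by
      have h2 : ContinuousWithinAt (quantile ν) (Set.Ioo t 1) t :=
        hc.mono (Set.Ioo_subset_Ioo_left ht.1.le)
      have h3 := h2.eventually (gt_mem_nhds hr1)
      rwa [nhdsWithin_Ioo_eq_nhdsGT ht.2] at h3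
    obtain ⟨s, hs1, hs2⟩ := (h1.and (Ioo_mem_nhdsGT ht.2)).exists
    have h4 : t < cdf ν r :=
      hs2.1.trans_le ((quantile_le_iff ν ⟨ht.1.trans hs2.1, hs2.2⟩).1 hs1.le)
    filter_upwards [(hrat r).eventually (lt_mem_nhds h4), eventually_ge_atTop 1] with n hn hn1
    exact ((rankStat_ceil_le_iff X ω hn1 ht' r).2 hn.le).trans_lt hr2

lemma ae_tendsto_rankStat_quantile
    (hrat : ∀ r : ℚ, Tendsto (fun n => empMean X n ω ((Set.Iic (r : ℝ)).indicator 1)) atTop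
      (𝓝 (cdf ν r))) :
    ∀ᵐ t ∂unif, Tendsto (fun n : ℕ => rankStat X n ω ⌈(n : ℝ) * t⌉₊) atTop
      (𝓝 (quantile ν t)) := by
  have hcount := (monotoneOn_quantile ν).countable_not_continuousWithinAt
  filter_upwards [ae_unif_mem_Ioo, hcount.ae_notMem unif] with t ht htc
  exact tendsto_rankStat_quantile ν hrat ht (by_contra fun h => htc ⟨ht, h⟩)

lemma measurable_comp_ceil {β : Type*} [MeasurableSpace β] (Φ : ℕ → β) (n : ℕ) :
    Measurable fun t : ℝ => Φ ⌈(n : ℝ) * t⌉₊ :=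
  (Measurable.of_discrete (f := Φ)).comp (Nat.measurable_ceil.comp (measurable_const_mul _))

lemma eLpNorm_comp_ceil {n : ℕ} (hn : 1 ≤ n) (Φ : ℕ → ℝ) {p : ℝ≥0∞} (hp0 : p ≠ 0) (hp : p ≠ ∞) :
    eLpNorm (fun t : ℝ => Φ ⌈(n : ℝ) * t⌉₊) p unif =
      ENNReal.ofReal ((n : ℝ)⁻¹ * ∑ i : Fin n, |Φ (i + 1)| ^ p.toReal) ^ (1 / p.toReal) := by
  rw [eLpNorm_eq_lintegral_rpow_enorm_toReal hp0 hp]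
  congr 1
  rw [← integral_comp_ceil hn fun k => |Φ k| ^ p.toReal, ofReal_integral_eq_lintegral_ofReal
    (integrable_comp_ceil hn fun k => |Φ k| ^ p.toReal)
    (Eventually.of_forall fun t => by positivity)]
  refine lintegral_congr fun t => ?_
  rw [← Real.enorm_abs, Real.enorm_of_nonneg (abs_nonneg _),
    ENNReal.ofReal_rpow_of_nonneg (abs_nonneg _) ENNReal.toReal_nonneg]

lemma eLpNorm_comp_rankStat {n : ℕ} (hn : 1 ≤ n) (f : ℝ → ℝ) {p : ℝ≥0∞} (hp0 : p ≠ 0)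
    (hp : p ≠ ∞) :
    eLpNorm (fun t : ℝ => f (rankStat X n ω ⌈(n : ℝ) * t⌉₊)) p unif =
      ENNReal.ofReal (empMean X n ω fun x => |f x| ^ p.toReal) ^ (1 / p.toReal) := by
  rw [eLpNorm_comp_ceil hn (fun k => f (rankStat X n ω k)) hp0 hp, ← sum_comp_orderStat]
  simp_rw [rankStat_succ]

lemma tendsto_eLpNorm_bounded_comp_rankStat [IsProbabilityMeasure ν]
    (hrat : ∀ r : ℚ, Tendsto (fun n => empMean X n ω ((Set.Iic (r : ℝ)).indicator 1)) atTop
      (𝓝 (cdf ν r))) (g : BoundedContinuousFunction ℝ ℝ) {p : ℝ≥0∞} (hp0 : p ≠ 0)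
    (hp : p ≠ ∞) :
    Tendsto (fun n : ℕ => eLpNorm
      (fun t : ℝ => g (rankStat X n ω ⌈(n : ℝ) * t⌉₊) - g (quantile ν t)) p unif) atTop (𝓝 0) := by
  have hr : 0 < p.toReal := ENNReal.toReal_pos hp0 hp
  simp_rw [eLpNorm_eq_lintegral_rpow_enorm_toReal hp0 hp]
  have hlim : Tendsto (fun n : ℕ => ∫⁻ t, ‖g (rankStat X n ω ⌈(n : ℝ) * t⌉₊) -
      g (quantile ν t)‖ₑ ^ p.toReal ∂unif) atTop (𝓝 (∫⁻ _, 0 ∂unif)) := by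
    refine tendsto_lintegral_of_dominated_convergence'
      (fun _ => ENNReal.ofReal (2 * ‖g‖) ^ p.toReal) ?_ ?_ ?_ ?_
    · intro n
      exact (((measurable_comp_ceil (fun k => g (rankStat X n ω k)) n).aemeasurable.sub
        (g.continuous.measurable.comp_aemeasurable (aemeasurable_quantile ν))).enorm).pow_const _
    · intro n
      refine Eventually.of_forall fun t => ?_
      refine ENNReal.rpow_le_rpow ?_ hr.le
      rw [← ofReal_norm]
      refine ENNReal.ofReal_le_ofReal ((norm_sub_le _ _).trans ?_)
      linarith [g.norm_coe_le_norm (rankStat X n ω ⌈(n : ℝ) * t⌉₊), g.norm_coe_le_norm (quantile ν t)]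
    · simp only [lintegral_const, measure_univ, mul_one]
      exact (ENNReal.rpow_lt_top_of_nonneg hr.le ENNReal.ofReal_ne_top).ne
    · filter_upwards [ae_tendsto_rankStat_quantile ν hrat] with t ht
      have h1 := ((g.continuous.tendsto _).comp ht).sub_const (g (quantile ν t))
      rw [sub_self] at h1
      have h2 := (ENNReal.continuous_rpow_const (y := p.toReal)).tendsto _ |>.comp h1.enorm
      simpa [hr, Function.comp_def] using h2
  rw [lintegral_zero] at hlim
  have h3 := (ENNReal.continuous_rpow_const (y := 1 / p.toReal)).tendsto _ |>.comp hlim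
  simpa [hr, Function.comp_def] using h3

/-- Convergence in `Lᵖ` of `h` along empirical quantiles, given the law of large numbers for the
approximation errors of bounded continuous functions. -/
lemma tendsto_eLpNorm_comp_rankStat [IsProbabilityMeasure ν] {h : ℝ → ℝ} (hh : Measurable h)
    {p : ℝ≥0∞} (hp1 : 1 ≤ p) (hp : p ≠ ∞)
    (hrat : ∀ r : ℚ, Tendsto (fun n => empMean X n ω ((Set.Iic (r : ℝ)).indicator 1)) atTop
      (𝓝 (cdf ν r))) (g : ℕ → BoundedContinuousFunction ℝ ℝ) (hg : ∀ k, MemLp (h - ⇑(g k)) p ν)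
    (hgk : Tendsto (fun k => eLpNorm (h - ⇑(g k)) p ν) atTop (𝓝 0))
    (hlln : ∀ k, Tendsto (fun n => empMean X n ω fun x => |h x - g k x| ^ p.toReal) atTop
      (𝓝 (∫ x, |h x - g k x| ^ p.toReal ∂ν))) :
    Tendsto (fun n : ℕ => eLpNorm
      (fun t : ℝ => h (rankStat X n ω ⌈(n : ℝ) * t⌉₊) - h (quantile ν t)) p unif) atTop (𝓝 0) := by
  have hp0 : p ≠ 0 := (zero_lt_one.trans_le hp1).ne'
  have hr : 0 < p.toReal := ENNReal.toReal_pos hp0 hp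
  have mq := aemeasurable_quantile ν
  refine ENNReal.tendsto_nhds_zero.2 fun ε hε => ?_
  have hε3 : 0 < ε / 3 := ENNReal.div_pos hε.ne' (by norm_num)
  obtain ⟨k, hk⟩ := (hgk.eventually (gt_mem_nhds hε3)).exists
  have e1 : ENNReal.ofReal (∫ x, |h x - g k x| ^ p.toReal ∂ν) ^ (1 / p.toReal) =
      eLpNorm (h - ⇑(g k)) p ν := by
    rw [eLpNorm_eq_lintegral_rpow_enorm_toReal hp0 hp]
    congr 1
    have hi := (hg k).integrable_norm_rpow hp0 hp
    rw [ofReal_integral_eq_lintegral_ofReal (by simpa using hi)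
      (Eventually.of_forall fun t => by positivity)]
    refine lintegral_congr fun t => ?_
    rw [← Real.enorm_abs, Real.enorm_of_nonneg (abs_nonneg _),
      ENNReal.ofReal_rpow_of_nonneg (abs_nonneg _) ENNReal.toReal_nonneg]
    rfl
  have t1 : Tendsto (fun n : ℕ => eLpNorm (fun t : ℝ => h (rankStat X n ω ⌈(n : ℝ) * t⌉₊) -
      g k (rankStat X n ω ⌈(n : ℝ) * t⌉₊)) p unif) atTop (𝓝 (eLpNorm (h - ⇑(g k)) p ν)) := by
    rw [← e1]
    refine (((ENNReal.continuous_rpow_const (y := 1 / p.toReal)).tendsto _).comp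
      ((ENNReal.continuous_ofReal.tendsto _).comp (hlln k))).congr' ?_
    filter_upwards [eventually_ge_atTop 1] with n hn
    exact (eLpNorm_comp_rankStat hn (fun x => h x - g k x) hp0 hp).symm
  have e3 : eLpNorm (fun t => g k (quantile ν t) - h (quantile ν t)) p unif =
      eLpNorm (h - ⇑(g k)) p ν := by
    have h0 : (fun t => g k (quantile ν t) - h (quantile ν t)) =
        -((h - ⇑(g k)) ∘ quantile ν) := by ext t; simp
    rw [h0, eLpNorm_neg]
    have h1 := eLpNorm_map_measure (p := p) (μ := unif) (f := quantile ν) (g := h - ⇑(g k))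
      (hh.sub (g k).continuous.measurable).aestronglyMeasurable mq
    rw [← h1, map_quantile]
  filter_upwards [t1.eventually (gt_mem_nhds hk),
    (tendsto_eLpNorm_bounded_comp_rankStat ν hrat (g k) hp0 hp).eventually (gt_mem_nhds hε3)]
    with n h1 h2
  -- Three errors: approximation on the sample (law of large numbers), movement of the quantiles
  -- under `g k`, and approximation under the law itself.
  set A : ℝ → ℝ := fun t => h (rankStat X n ω ⌈(n : ℝ) * t⌉₊) - g k (rankStat X n ω ⌈(n : ℝ) * t⌉₊)
  set B : ℝ → ℝ := fun t => g k (rankStat X n ω ⌈(n : ℝ) * t⌉₊) - g k (quantile ν t)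
  set C : ℝ → ℝ := fun t => g k (quantile ν t) - h (quantile ν t)
  have mA : AEStronglyMeasurable A unif := (measurable_comp_ceil
    (fun j => h (rankStat X n ω j) - g k (rankStat X n ω j)) n).aestronglyMeasurable
  have mgq := (g k).continuous.measurable.comp_aemeasurable mq
  have mB : AEStronglyMeasurable B unif := ((measurable_comp_ceil
    (fun j => g k (rankStat X n ω j)) n).aemeasurable.sub mgq).aestronglyMeasurable
  have mC : AEStronglyMeasurable C unif := (mgq.sub (hh.comp_aemeasurable mq)).aestronglyMeasurable
  have eABC : (fun t : ℝ => h (rankStat X n ω ⌈(n : ℝ) * t⌉₊) - h (quantile ν t)) = A + B + C := by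
    ext t; simp only [A, B, C, Pi.add_apply]; ring
  rw [eABC]
  calc eLpNorm (A + B + C) p unif ≤ eLpNorm A p unif + eLpNorm B p unif + eLpNorm C p unif :=
        (eLpNorm_add_le (mA.add mB) mC hp1).trans (add_le_add_left (eLpNorm_add_le mA mB hp1) _)
    _ ≤ ε / 3 + ε / 3 + ε / 3 := by
        gcongr
        rw [e3]; exact hk.le
    _ = ε := ENNReal.add_thirds ε

end Empirical

/-! ### Weights and Hölder's inequality -/

section Weights
variable {c : ℕ → ℕ → ℝ} {h : ℝ → ℝ}

lemma stepWeight_eq {n : ℕ} :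
    stepWeight c n = fun t : ℝ => (fun k => c n (max 1 k)) ⌈(n : ℝ) * t⌉₊ := rfl

lemma exists_eLpNorm_stepWeight_le {q : ℝ≥0∞} (hq0 : q ≠ 0) (hc : WeightsBounded c q) :
    ∃ K : ℝ≥0∞, K ≠ ∞ ∧ ∀ n, 1 ≤ n → eLpNorm (stepWeight c n) q unif ≤ K := by
  obtain ⟨B, hB⟩ := hc
  have hB' : ∀ n, 1 ≤ n → weightSize c q n ≤ B := fun n hn => hB ⟨n, hn, rfl⟩
  rcases eq_or_ne q ∞ with rfl | hq
  · refine ⟨ENNReal.ofReal B, ENNReal.ofReal_ne_top, fun n hn => ?_⟩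
    rw [eLpNorm_exponent_top]
    refine eLpNormEssSup_le_of_ae_bound ?_
    filter_upwards [ae_unif_mem_Ioo] with t ht
    obtain ⟨h1, h2⟩ := ceil_mul_mem hn ⟨ht.1, ht.2.le⟩
    have h3 := hB' n hn
    rw [weightSize, if_pos rfl] at h3
    refine le_trans ?_ h3
    have h4 := le_ciSup (Set.finite_range fun i : Fin n => |c n (i + 1)|).bddAbove
      (⟨⌈(n : ℝ) * t⌉₊ - 1, by omega⟩ : Fin n)
    rw [stepWeight, max_eq_right h1, Real.norm_eq_abs]
    have h5 : ⌈(n : ℝ) * t⌉₊ - 1 + 1 = ⌈(n : ℝ) * t⌉₊ := by omega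
    simpa only [h5] using h4
  · refine ⟨ENNReal.ofReal B ^ (1 / q.toReal), (ENNReal.rpow_lt_top_of_nonneg (by positivity)
      ENNReal.ofReal_ne_top).ne, fun n hn => ?_⟩
    rw [stepWeight_eq, eLpNorm_comp_ceil hn (fun k => c n (max 1 k)) hq0 hq]
    refine ENNReal.rpow_le_rpow (ENNReal.ofReal_le_ofReal ?_) (by positivity)
    have h3 := hB' n hn
    rw [weightSize, if_neg hq] at h3
    simpa using h3

variable {ν : Measure ℝ} {p q : ℝ≥0∞}

lemma integrable_stepWeight_mul (hpq : q.HolderTriple p 1) (hc : WeightsBounded c q)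
    (hq0 : q ≠ 0) (hH : MemLp (kernelQuantile h ν) p unif) {n : ℕ} (hn : 1 ≤ n) :
    Integrable (fun t => stepWeight c n t * kernelQuantile h ν t) unif := by
  obtain ⟨K, hK, hKn⟩ := exists_eLpNorm_stepWeight_le hq0 hc
  have h1 : MemLp (stepWeight c n) q unif :=
    ⟨(measurable_comp_ceil (fun k => c n (max 1 k)) n).aestronglyMeasurable,
      (hKn n hn).trans_lt hK.lt_top⟩
  exact memLp_one_iff_integrable.1 (hH.mul h1)

variable {Ω : Type*} {X : ℕ → Ω → ℝ} {ω : Ω}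

lemma lStatistic_eq_integral {n : ℕ} (hn : 1 ≤ n) : lStatistic c h X n ω =
    ∫ t, stepWeight c n t * h (rankStat X n ω ⌈(n : ℝ) * t⌉₊) ∂unif := by
  have := integral_comp_ceil hn fun k => c n (max 1 k) * h (rankStat X n ω k)
  simp only [stepWeight]
  rw [this, lStatistic]
  simp [rankStat_succ]

/-- Hölder's inequality reduces the convergence of `L`-statistics to `Lᵖ` convergence along
empirical quantiles. -/
lemma tendsto_lStatistic_sub_centering (hpq : q.HolderTriple p 1) (hq0 : q ≠ 0)
    (hc : WeightsBounded c q) (hh : Measurable h) (hH : MemLp (kernelQuantile h ν) p unif)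
    (hlim : Tendsto (fun n : ℕ => eLpNorm
      (fun t : ℝ => h (rankStat X n ω ⌈(n : ℝ) * t⌉₊) - h (quantile ν t)) p unif) atTop (𝓝 0)) :
    Tendsto (fun n : ℕ => lStatistic c h X n ω - centering c h ν n) atTop (𝓝 0) := by
  obtain ⟨K, hK, hKn⟩ := exists_eLpNorm_stepWeight_le hq0 hc
  have hlim' := ENNReal.Tendsto.const_mul hlim (Or.inr hK)
  rw [mul_zero] at hlim'
  rw [tendsto_zero_iff_enorm_tendsto_zero]
  refine tendsto_of_tendsto_of_tendsto_of_le_of_le' tendsto_const_nhds hlim'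
    (Eventually.of_forall fun _ => zero_le) ?_
  filter_upwards [eventually_ge_atTop 1] with n hn
  have hint : Integrable (fun t => stepWeight c n t * h (rankStat X n ω ⌈(n : ℝ) * t⌉₊)) unif :=
    integrable_comp_ceil hn fun k => c n (max 1 k) * h (rankStat X n ω k)
  have e : lStatistic c h X n ω - centering c h ν n = ∫ t, (stepWeight c n • fun t : ℝ =>
      h (rankStat X n ω ⌈(n : ℝ) * t⌉₊) - h (quantile ν t)) t ∂unif := by
    rw [lStatistic_eq_integral hn, centering, intervalIntegral.integral_of_le zero_le_one,
      ← integral_sub hint (integrable_stepWeight_mul hpq hc hq0 hH hn)]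
    refine integral_congr_ae (Eventually.of_forall fun t => ?_)
    simp only [Pi.smul_apply', smul_eq_mul, kernelQuantile]
    ring
  rw [e]
  refine (enorm_integral_le_lintegral_enorm _).trans ?_
  rw [← eLpNorm_one_eq_lintegral_enorm]
  refine (eLpNorm_smul_le_mul_eLpNorm (p := q) (q := p) ?_ ?_).trans (mul_le_mul_left (hKn n hn) _)
  · exact ((measurable_comp_ceil (fun j => h (rankStat X n ω j)) n).aemeasurable.sub
      (hh.comp_aemeasurable (aemeasurable_quantile ν))).aestronglyMeasurable
  · exact (measurable_comp_ceil (fun k => c n (max 1 k)) n).aestronglyMeasurable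

end Weights

/-! ### Almost sure convergence under the two conditions -/

section Main
variable {Ω : Type*} [MeasurableSpace Ω] {P : Measure Ω} [IsProbabilityMeasure P]
  {X : ℕ → Ω → ℝ} {c : ℕ → ℕ → ℝ} {h : ℝ → ℝ}

lemma ae_tendsto_empMean (hX : ∀ i, 1 ≤ i → Measurable (X i))
    (hident : ∀ i, 1 ≤ i → IdentDistrib (X i) (X 1) P P)
    (hsum : Summable fun n : ℕ => √(phiCoeff P X (2 ^ (n + 1))))
    {f : ℝ → ℝ} (hf : Measurable f) (hint : Integrable f (P.map (X 1))) :
    ∀ᵐ ω ∂P, Tendsto (fun n : ℕ => empMean X n ω f) atTop (𝓝 (∫ x, f x ∂P.map (X 1))) := by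
  have hX1 : AEMeasurable (X 1) P := (hX 1 le_rfl).aemeasurable
  rw [integral_map hX1 hf.aestronglyMeasurable]
  exact strong_law_phiMixing hX hident hsum hf (hint.comp_aemeasurable hX1)

lemma ae_tendsto_empMean_indicator (hX : ∀ i, 1 ≤ i → Measurable (X i))
    (hident : ∀ i, 1 ≤ i → IdentDistrib (X i) (X 1) P P)
    (hsum : Summable fun n : ℕ => √(phiCoeff P X (2 ^ (n + 1))))
    {s : Set ℝ} (hs : MeasurableSet s) :
    ∀ᵐ ω ∂P, Tendsto (fun n : ℕ => empMean X n ω (s.indicator 1)) atTop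
      (𝓝 ((P.map (X 1)).real s)) := by
  have : IsProbabilityMeasure (P.map (X 1)) :=
    Measure.isProbabilityMeasure_map (hX 1 le_rfl).aemeasurable
  have h1 := ae_tendsto_empMean hX hident hsum (f := s.indicator 1) (measurable_one.indicator hs)
    ((integrable_const (1 : ℝ)).indicator hs)
  rwa [integral_indicator_one hs] at h1

/-- Uniform convergence along empirical quantiles when `H` extends continuously to `[0, 1]`. -/
lemma ae_tendsto_eLpNorm_top (hX : ∀ i, 1 ≤ i → Measurable (X i))
    (hident : ∀ i, 1 ≤ i → IdentDistrib (X i) (X 1) P P)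
    (hsum : Summable fun n : ℕ => √(phiCoeff P X (2 ^ (n + 1)))) (hh : Measurable h)
    {G : ℝ → ℝ} (hG : Continuous G)
    (hGH : Set.EqOn G (kernelQuantile h (P.map (X 1))) (Set.Ioo 0 1)) :
    ∀ᵐ ω ∂P, Tendsto (fun n : ℕ => eLpNorm (fun t : ℝ => h (rankStat X n ω ⌈(n : ℝ) * t⌉₊) -
      h (quantile (P.map (X 1)) t)) ∞ unif) atTop (𝓝 0) := by
  set ν := P.map (X 1) with hν
  have : IsProbabilityMeasure ν := Measure.isProbabilityMeasure_map (hX 1 le_rfl).aemeasurable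
  have a1 : ∀ᵐ ω ∂P, ∀ r : ℚ, Tendsto
      (fun n => empMean X n ω ((Set.Iic (quantile ν r)).indicator 1)) atTop
      (𝓝 (cdf ν (quantile ν r))) := ae_all_iff.2 fun r => by
    rw [cdf_eq_real]
    exact ae_tendsto_empMean_indicator hX hident hsum measurableSet_Iic
  have a2 : ∀ᵐ ω ∂P, ∀ r : ℚ, Tendsto
      (fun n => empMean X n ω ((Set.Iio (quantile ν r)).indicator 1)) atTop
      (𝓝 (ν.real (Set.Iio (quantile ν r)))) := ae_all_iff.2 fun r =>
    ae_tendsto_empMean_indicator hX hident hsum measurableSet_Iio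
  -- The exceptional set of `x` is null for the common law, so almost surely no observation falls in
  -- it; every order statistic is an observation.
  have a3 : ∀ᵐ ω ∂P, ∀ i, 1 ≤ i → G (cdf ν (X i ω)) = h (X i ω) ∧
      G (ν.real (Set.Iio (X i ω))) = h (X i ω) := by
    refine ae_all_iff.2 fun i => eventually_imp_distrib_left.2 fun hi => ?_
    have h1 := ae_eq_comp_cdf ν hh hG hGH
    nth_rewrite 3 [hν] at h1
    rw [← (hident i hi).map_eq] at h1
    exact ae_of_ae_map (hX i hi).aemeasurable h1
  filter_upwards [a1, a2, a3] with ω h1 h2 h3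
  refine ENNReal.tendsto_nhds_zero.2 fun ε' hε' => ?_
  obtain ⟨ε, -, hε, hεε'⟩ := ENNReal.lt_iff_exists_real_btwn.1 hε'
  have hε0 : 0 < ε := by simpa using hε
  obtain ⟨δ, hδ, hu⟩ := Metric.uniformContinuousOn_iff.1
    ((isCompact_Icc (a := (0 : ℝ)) (b := 1)).uniformContinuousOn_of_continuous hG.continuousOn)
    ε hε0
  filter_upwards [eventually_forall_empMean_close ν h1 h2 (half_pos hδ), eventually_ge_atTop 1]
    with n hn hn1
  refine le_trans ?_ hεε'.le
  rw [eLpNorm_exponent_top]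
  refine eLpNormEssSup_le_of_ae_bound ?_
  filter_upwards [ae_unif_mem_Ioo] with t ht
  have ht' : t ∈ Set.Ioc (0 : ℝ) 1 := ⟨ht.1, ht.2.le⟩
  have htI : t ∈ Set.Icc (0 : ℝ) 1 := ⟨ht.1.le, ht.2.le⟩
  obtain ⟨j, hj, hxj⟩ := exists_rankStat_ceil_eq X ω hn1 ht'
  -- With `x` the order statistic, `F_n(x-) < t ≤ F_n(x)`. Hence `t` exceeds `F(x)`, or falls below
  -- `F(x-)`, by less than `δ`, or else lies on the jump, where `F⁻¹(t) = x`.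
  have k1 := (rankStat_ceil_le_iff X ω hn1 ht' _).1 le_rfl
  have k2 := not_le.1 (mt (rankStat_ceil_lt_iff X ω hn1 ht' _).2 (lt_irrefl _))
  set x := rankStat X n ω ⌈(n : ℝ) * t⌉₊
  obtain ⟨hx1, hx2⟩ := h3 j hj
  rw [← hxj] at hx1 hx2
  obtain ⟨b1, b2⟩ := hn x
  have hGt : G t = h (quantile ν t) := hGH ht
  by_cases c1 : cdf ν x < t
  · have := hu (cdf ν x) ⟨cdf_nonneg ν x, cdf_le_one ν x⟩ t htI
      (by rw [Real.dist_eq, abs_lt]; constructor <;> linarith)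
    rw [hx1, hGt, dist_eq_norm] at this
    exact this.le
  by_cases c2 : t ≤ ν.real (Set.Iio x)
  · have := hu (ν.real (Set.Iio x)) ⟨measureReal_nonneg, measureReal_le_one⟩ t htI
      (by rw [Real.dist_eq, abs_lt]; constructor <;> linarith)
    rw [hx2, hGt, dist_eq_norm] at this
    exact this.le
  · rw [quantile_eq_of_mem_Ioc ν ht ⟨not_le.1 c2, not_lt.1 c1⟩]
    simpa using hε0.le

lemma ae_tendsto_eLpNorm_of_memLp (hX : ∀ i, 1 ≤ i → Measurable (X i))
    (hident : ∀ i, 1 ≤ i → IdentDistrib (X i) (X 1) P P)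
    (hsum : Summable fun n : ℕ => √(phiCoeff P X (2 ^ (n + 1)))) (hh : Measurable h)
    {p : ℝ≥0∞} (hp1 : 1 ≤ p) (hp : p ≠ ∞) (hmem : MemLp h p (P.map (X 1))) :
    ∀ᵐ ω ∂P, Tendsto (fun n : ℕ => eLpNorm (fun t : ℝ => h (rankStat X n ω ⌈(n : ℝ) * t⌉₊) -
      h (quantile (P.map (X 1)) t)) p unif) atTop (𝓝 0) := by
  set ν := P.map (X 1)
  have : IsProbabilityMeasure ν := Measure.isProbabilityMeasure_map (hX 1 le_rfl).aemeasurable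
  have hp0 : p ≠ 0 := (zero_lt_one.trans_le hp1).ne'
  have a1 : ∀ᵐ ω ∂P, ∀ r : ℚ, Tendsto
      (fun n => empMean X n ω ((Set.Iic (r : ℝ)).indicator 1)) atTop (𝓝 (cdf ν r)) :=
    ae_all_iff.2 fun r => by
      rw [cdf_eq_real]
      exact ae_tendsto_empMean_indicator hX hident hsum measurableSet_Iic
  have hex : ∀ k : ℕ, ∃ g : BoundedContinuousFunction ℝ ℝ,
      eLpNorm (h - ⇑g) p ν ≤ (k : ℝ≥0∞)⁻¹ ∧ MemLp g p ν := fun k =>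
    hmem.exists_boundedContinuous_eLpNorm_sub_le hp (ENNReal.inv_ne_zero.2 (ENNReal.natCast_ne_top k))
  choose g hg1 hg2 using hex
  have hgk : Tendsto (fun k => eLpNorm (h - ⇑(g k)) p ν) atTop (𝓝 0) :=
    tendsto_of_tendsto_of_tendsto_of_le_of_le tendsto_const_nhds
      ENNReal.tendsto_inv_nat_nhds_zero (fun _ => zero_le) hg1
  have a2 : ∀ᵐ ω ∂P, ∀ k, Tendsto (fun n => empMean X n ω fun x => |h x - g k x| ^ p.toReal) atTop
      (𝓝 (∫ x, |h x - g k x| ^ p.toReal ∂ν)) := ae_all_iff.2 fun k => by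
    refine ae_tendsto_empMean hX hident hsum ?_ ?_
    · exact (hh.sub (g k).continuous.measurable).abs.pow_const _
    · simpa using (hmem.sub (hg2 k)).integrable_norm_rpow hp0 hp
  filter_upwards [a1, a2] with ω h1 h2
  exact tendsto_eLpNorm_comp_rankStat ν hh hp1 hp h1 g (fun k => hmem.sub (hg2 k)) hgk h2

end Main

end LStat

theorem theorem2 {Ω : Type*} [MeasurableSpace Ω] (P : Measure Ω) [IsProbabilityMeasure P]
    (X : ℕ → Ω → ℝ) (hX : ∀ i, 1 ≤ i → Measurable (X i))
    (hident : ∀ i, 1 ≤ i → IdentDistrib (X i) (X 1) P P)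
    (hmix : LStat.IsPhiMixing P X)
    (hsum : Summable fun n : ℕ => Real.sqrt (LStat.phiCoeff P X (2 ^ (n + 1))))
    (h : ℝ → ℝ) (hh : Measurable h) (c : ℕ → ℕ → ℝ)
    (hcond : LStat.ConditionI c h (P.map (X 1)) ∨ LStat.ConditionII P X c h) :
    (∀ n : ℕ, 1 ≤ n → IntervalIntegrable
      (fun t => LStat.stepWeight c n t * LStat.kernelQuantile h (P.map (X 1)) t) volume 0 1) ∧
    ∀ᵐ ω ∂P, Tendsto
      (fun n : ℕ => LStat.lStatistic c h X n ω - LStat.centering c h (P.map (X 1)) n)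
      atTop (𝓝 0) := by
  have hX1 : AEMeasurable (X 1) P := (hX 1 le_rfl).aemeasurable
  have : IsProbabilityMeasure (P.map (X 1)) := Measure.isProbabilityMeasure_map hX1
  have hmq := LStat.aemeasurable_quantile (P.map (X 1))
  suffices ∃ p q : ℝ≥0∞, q.HolderTriple p 1 ∧ q ≠ 0 ∧ LStat.WeightsBounded c q ∧
      MemLp (LStat.kernelQuantile h (P.map (X 1))) p LStat.unif ∧
      ∀ᵐ ω ∂P, Tendsto (fun n : ℕ => eLpNorm (fun t : ℝ =>
        h (LStat.rankStat X n ω ⌈(n : ℝ) * t⌉₊) - h (LStat.quantile (P.map (X 1)) t)) p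
          LStat.unif) atTop (𝓝 0) by
    obtain ⟨p, q, hpq, hq0, hc, hH, hlim⟩ := this
    refine ⟨fun n hn => ?_, ?_⟩
    · rw [intervalIntegrable_iff_integrableOn_Ioc_of_le zero_le_one]
      exact LStat.integrable_stepWeight_mul hpq hc hq0 hH hn
    · filter_upwards [hlim] with ω hω
      exact LStat.tendsto_lStatistic_sub_centering hpq hq0 hc hh hH hω
  rcases hcond with ⟨⟨g, hgc, hgH⟩, hc⟩ | ⟨p, q, hp1, hp, hpq, hmem, hc⟩
  -- Extending by constants outside `[0, 1]` gives a globally continuous function, and the exponents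
  -- are `p = ∞`, `q = 1`.
  · set G : ℝ → ℝ := Set.IccExtend zero_le_one ((Set.Icc (0 : ℝ) 1).domRestrict g)
    have hG : Continuous G := hgc.domRestrict.Icc_extend'
    have hGH : Set.EqOn G (LStat.kernelQuantile h (P.map (X 1))) (Set.Ioo 0 1) := fun t ht => by
      rw [← hgH ht]
      exact Set.IccExtend_of_mem zero_le_one _ ⟨ht.1.le, ht.2.le⟩
    refine ⟨∞, 1, ⟨by simp⟩, one_ne_zero, hc, ?_,
      LStat.ae_tendsto_eLpNorm_top hX hident hsum hh hG hGH⟩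
    obtain ⟨C, hC⟩ := (isCompact_Icc (a := (0 : ℝ)) (b := 1)).exists_bound_of_continuousOn
      hG.continuousOn
    refine memLp_top_of_bound (hh.comp_aemeasurable hmq).aestronglyMeasurable C ?_
    filter_upwards [LStat.ae_unif_mem_Ioo] with t ht
    rw [← hGH ht]
    exact hC t ⟨ht.1.le, ht.2.le⟩
  · have hmem' : MemLp h p (P.map (X 1)) :=
      (memLp_map_measure_iff hh.aestronglyMeasurable hX1).2 hmem
    refine ⟨p, q, ⟨by rw [add_comm, hpq, inv_one]⟩, ?_, hc, ?_,
      LStat.ae_tendsto_eLpNorm_of_memLp hX hident hsum hh hp1 hp hmem'⟩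
    · rintro rfl
      simp at hpq
    · have h1 := hmem'
      rw [← LStat.map_quantile (P.map (X 1))] at h1
      exact h1.comp_of_map hmq
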